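/- **Setting.** For each $n$ let $k_n\ge 1$, let $p=p^{(n)}$ be a probability vector on $[k_n]$, and let $Q=Q^{(n)}$ be a symmetric $k_n\times k_n$ matrix with entries in $[-1,1]$. A graph from $\mathrm{SBM}(n;p,Q)$ on vertex set $[n]$ is drawn by choosing i.i.d. labels $x_1,\dots,x_n\sim p$ and then, conditionally on the labels, joining each pair $u<v$ independently with probability $(1+Q_{x_u,x_v})/2$. $\mathbb G(n,1/2)$ is the uniform random graph on $[n]$. A degree-$D$ test is a sequence $f=(f_n)$ of polynomials of degree at most $D$ in the edge indicators of a graph on $[n]$. A sequence of statistics $f=(f_n)$ distinguishes $\mathbb G(n,1/2)$ from $\mathrm{SBM}(n;p,Q)$ with high probability if $$\big|\mathbb E_{\mathbb G(n,1/2)}f_n-\mathbb E_{\mathrm{SBM}(n;p,Q)}f_n\big|=\omega\Big(\max\big(\mathrm{Var}_{\mathbb G(n,1/2)}f_n,\ \mathrm{Var}_{\mathrm{SBM}(n;p,Q)}f_n\big)^{1/2}\Big),$$ that is, for every $C$ the left side is strictly larger than $C$ times the maximum of the standard deviations for all large $n$. The signed count of a graph $H$ in $G$ is $\mathrm{SC}_H(G)=\sum_{S}\prod_{e\in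 E(S)}(2\cdot\mathbf 1[e\in E(G)]-1)$, the sum being over all copies $S$ of $H$ in the complete graph on $[n]$. $\mathrm{Star}_t$ is the star with $t$ edges. **Corollary.** Let all entries of $Q$ be non-negative, and suppose that $\min_{i:\,p_i>0}p_i=\omega(1/n)$. Let $D$ be a constant, independent of $n$. If there is a degree-$D$ test that distinguishes $\mathbb G(n,1/2)$ from $\mathrm{SBM}(n;p,Q)$ with high probability, then there are $t=t_n\in\{1,\dots,D\}$ such that the signed star counts $\mathrm{SC}_{\mathrm{Star}_{t_n}}$ distinguish $\mathbb G(n,1/2)$ from $\mathrm{SBM}(n;p,Q)$ with high probability. -/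

import Mathlib

open Filter

noncomputable section

open scoped Classical in
/-- Expectation of `f` on the finite set of graphs with vertex set `Fin n`,
each graph `G` having probability `w G`. -/
def graphExp {n : ℕ} (w f : SimpleGraph (Fin n) → ℝ) : ℝ :=
  ∑ G : SimpleGraph (Fin n), w G * f G

/-- Variance of `f` when each graph `G` has probability `w G`. -/
def graphVar {n : ℕ} (w f : SimpleGraph (Fin n) → ℝ) : ℝ :=
  graphExp w fun G => (f G - graphExp w f) ^ 2

/-- The law of the Erdős–Rényi graph `G(n, 1/2)`: every graph has probability
`2 ^ (- n(n-1)/2)`. -/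
def erdosRenyiHalf (n : ℕ) (_G : SimpleGraph (Fin n)) : ℝ := (1 / 2) ^ n.choose 2

/-- The parameters of a stochastic block model on `k` communities: a probability vector `p` and a
symmetric matrix `Q` with entries in `[-1, 1]`. -/
structure SBM (k : ℕ) where
  p : Fin k → ℝ
  Q : Fin k → Fin k → ℝ
  p_nonneg : ∀ i, 0 ≤ p i
  p_sum : ∑ i, p i = 1
  Q_symm : ∀ i j, Q i j = Q j i
  Q_abs_le : ∀ i j, |Q i j| ≤ 1

open scoped Classical in
/-- The law of `SBM(n; p, Q)`: the vertices get i.i.d. labels `x v` with law `p`; given the labels,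
the pairs `u < v` are independently edges, with probability `(1 + Q (x u) (x v)) / 2`. The labels
are summed out. -/
def SBM.law {k : ℕ} (M : SBM k) (n : ℕ) (G : SimpleGraph (Fin n)) : ℝ :=
  ∑ x : Fin n → Fin k, (∏ v, M.p (x v)) *
    ∏ e : Fin n × Fin n with e.1 < e.2,
      if G.Adj e.1 e.2 then (1 + M.Q (x e.1) (x e.2)) / 2 else (1 - M.Q (x e.1) (x e.2)) / 2

open scoped Classical in
/-- `f` is a polynomial of degree at most `D` in the edge indicators of the graph. -/
def IsDegreeLE {n : ℕ} (D : ℕ) (f : SimpleGraph (Fin n) → ℝ) : Prop :=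
  ∃ P : MvPolynomial (⊤ : SimpleGraph (Fin n)).edgeSet ℝ, P.totalDegree ≤ D ∧
    ∀ G, f G = MvPolynomial.eval (fun e => if e.1 ∈ G.edgeSet then 1 else 0) P

open scoped Classical in
/-- The signed count of `H` in `G`: the sum, over all copies `S` of `H` in the complete graph on the
vertices of `G`, of the product over the edges `e` of `S` of `2 * 1[e ∈ G] - 1`. -/
def signedCount {W : Type} {n : ℕ} (H : SimpleGraph W) (G : SimpleGraph (Fin n)) : ℝ :=
  ∑ S : (⊤ : SimpleGraph (Fin n)).Subgraph with Nonempty (H ≃g S.coe),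
    ∏ e : Sym2 (Fin n) with e ∈ S.edgeSet, if e ∈ G.edgeSet then 1 else -1

/-- The star with `t` edges (and `t + 1` vertices). -/
def starWithEdges (t : ℕ) : SimpleGraph (Fin (t + 1)) := SimpleGraph.starGraph 0

/-- The sequence of statistics `f n` distinguishes the sequences of laws `P n` and `R n` with high
probability, in the usual sense for polynomial tests: the gap between the two expectations is
`ω` of both standard deviations. (By Chebyshev, thresholding `f n` halfway between the two
expectations then has error probabilities tending to `0`.) The inequality is strict, so that a
constant `f n` does not qualify. -/
def DistinguishesWHP (P R f : ∀ n : ℕ, SimpleGraph (Fin n) → ℝ) : Prop :=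
  ∀ C : ℝ, ∀ᶠ n in atTop,
    C * √(max (graphVar (P n) (f n)) (graphVar (R n) (f n))) <
      |graphExp (P n) (f n) - graphExp (R n) (f n)|

end

/-! Under $\mathbb G(n,1/2)$ the products of edge signs over edge sets $S$ are orthonormal
characters, and under the block model the character of $S$ has mean `M.coef S`, the label average of
the product of $Q$ over $S$. By Cauchy–Schwarz, the squared advantage of a degree-$D$ test is at
most its null variance times $\sum_{0<|S|\le D}\mathrm{coef}(S)^2$ (`SBM.sq_graphExp_sub_le`).

As $Q$ takes values in $[0,1]$, deleting edges never decreases a coefficient. Deleting edges as long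
as no vertex becomes isolated leaves vertex-disjoint stars, whose coefficient is a product of
moments $\mu_t$ of the row mean of $Q$ at a random label. There are at most $n^v$ vertex sets of
size $v$, so if $n^{(t+1)/2}\mu_t$ is bounded for $1\le t\le D$, then so is the sum
(`SBM.sum_coef_sq_le`). A successful test thus forces the largest of these quantities to infinity;
$t_n$ is the maximiser.

For that $t$ the labelled star count has mean of order $n^{t+1}\mu_t$, and only pairs of stars
sharing a vertex contribute to its variance (`SBM.pow_mul_coef_symmDiff_le`). With different
centres, such a pair prunes to disjoint stars with fewer leaves. With a common centre it yields a
moment of order up to $2t$, and $\mu_{2t}\le\mu_t^2/\min p$ is where $\min p=\omega(1/n)$ enters.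
Null coefficients are dominated by those of the model, so both variances are $o(\text{mean}^2)$
(`SBM.starSum_gap`). -/

noncomputable section

/-! ### Label averages, coefficients of stars, and moments of the row mean. -/

/-- Expectation over i.i.d. labels of the `n` vertices. -/
def SBM.labelExp {k : ℕ} (M : SBM k) {n : ℕ} (F : (Fin n → Fin k) → ℝ) : ℝ :=
  ∑ x : Fin n → Fin k, (∏ v, M.p (x v)) * F x

/-- The entry of `Q` at the labels of the two end points of a pair of vertices. -/
def SBM.weight {k : ℕ} (M : SBM k) {n : ℕ} (x : Fin n → Fin k) : Sym2 (Fin n) → ℝ :=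
  Sym2.lift ⟨fun u v => M.Q (x u) (x v), fun _ _ => M.Q_symm _ _⟩

/-- The Fourier coefficient of the block model at the edge set `S`. -/
def SBM.coef {k : ℕ} (M : SBM k) {n : ℕ} (S : Finset (Sym2 (Fin n))) : ℝ :=
  M.labelExp fun x => ∏ e ∈ S, M.weight x e

/-- The average of the row of `Q` with index `i`. -/
def SBM.rowMean {k : ℕ} (M : SBM k) (i : Fin k) : ℝ := ∑ j, M.p j * M.Q i j

/-- The `t`-th moment of the row average of a random label. -/
def SBM.moment {k : ℕ} (M : SBM k) (t : ℕ) : ℝ := ∑ i, M.p i * M.rowMean i ^ t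

/-- The edge set of the star with centre `c` and set of leaves `A`. -/
def starEdges {n : ℕ} (c : Fin n) (A : Finset (Fin n)) : Finset (Sym2 (Fin n)) :=
  A.image fun w => s(c, w)

namespace SBM

variable {k n : ℕ} (M : SBM k)

@[simp] lemma weight_mk (x : Fin n → Fin k) (u v : Fin n) :
    M.weight x s(u, v) = M.Q (x u) (x v) := rfl

lemma abs_weight_le (x : Fin n → Fin k) (e : Sym2 (Fin n)) : |M.weight x e| ≤ 1 := by
  induction e with | _ u v => exact M.Q_abs_le _ _

lemma weight_update (x : Fin n → Fin k) {e : Sym2 (Fin n)} {w : Fin n} (h : w ∉ e) (j : Fin k) :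
    M.weight (Function.update x w j) e = M.weight x e := by
  induction e with
  | _ u v =>
    simp only [Sym2.mem_iff, not_or] at h
    simp [Function.update_of_ne (Ne.symm h.1), Function.update_of_ne (Ne.symm h.2)]

lemma labelExp_one : M.labelExp (fun _ : Fin n → Fin k => 1) = 1 := by
  have h := Finset.prod_univ_sum (fun _ : Fin n => (Finset.univ : Finset (Fin k)))
    (fun _ j => M.p j)
  simp only [M.p_sum, Finset.prod_const_one, Fintype.piFinset_univ] at h
  simp [labelExp, ← h]

lemma labelExp_mono {F G : (Fin n → Fin k) → ℝ} (h : ∀ x, F x ≤ G x) :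
    M.labelExp F ≤ M.labelExp G :=
  Finset.sum_le_sum fun x _ =>
    mul_le_mul_of_nonneg_left (h x) (Finset.prod_nonneg fun _ _ => M.p_nonneg _)

lemma labelExp_nonneg {F : (Fin n → Fin k) → ℝ} (h : ∀ x, 0 ≤ F x) : 0 ≤ M.labelExp F :=
  Finset.sum_nonneg fun x _ => mul_nonneg (Finset.prod_nonneg fun _ _ => M.p_nonneg _) (h x)

lemma labelExp_const_mul (a : ℝ) (F : (Fin n → Fin k) → ℝ) :
    M.labelExp (fun x => a * F x) = a * M.labelExp F := by
  simp only [labelExp, Finset.mul_sum]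
  exact Finset.sum_congr rfl fun _ _ => by ring

/-- Averaging over the label of one vertex does not change the expectation. -/
lemma labelExp_average (w : Fin n) (F : (Fin n → Fin k) → ℝ) :
    M.labelExp (fun x => ∑ j, M.p j * F (Function.update x w j)) = M.labelExp F := by
  -- Fubini: the label of `w` is split off from the other labels.
  have key : ∀ G : (Fin n → Fin k) → ℝ, M.labelExp G =
      ∑ y : {v : Fin n // v ≠ w} → Fin k, (∏ v, M.p (y v)) *
        ∑ j, M.p j * G ((Equiv.funSplitAt w (Fin k)).symm (j, y)) := by
    intro G
    unfold labelExp
    rw [← (Equiv.funSplitAt w (Fin k)).symm.sum_comp, Fintype.sum_prod_type, Finset.sum_comm]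
    refine Finset.sum_congr rfl fun y _ => ?_
    rw [Finset.mul_sum]
    refine Finset.sum_congr rfl fun j _ => ?_
    rw [Fintype.prod_eq_mul_prod_subtype_ne _ w]
    have : ∀ v : {v : Fin n // v ≠ w}, ((Equiv.funSplitAt w (Fin k)).symm (j, y)) v = y v := by
      intro v; simp [Equiv.funSplitAt, Equiv.piSplitAt, v.2]
    simp only [this]
    simp [Equiv.funSplitAt, Equiv.piSplitAt]
    ring
  rw [key, key]
  refine Finset.sum_congr rfl fun y _ => ?_
  congr 1
  have : ∀ i j, Function.update ((Equiv.funSplitAt w (Fin k)).symm (i, y)) w j =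
      (Equiv.funSplitAt w (Fin k)).symm (j, y) := by
    intro i j; ext v
    by_cases h : v = w
    · subst h; simp [Equiv.funSplitAt, Equiv.piSplitAt]
    · simp [Equiv.funSplitAt, Equiv.piSplitAt, h]
  simp only [this, ← Finset.sum_mul, M.p_sum, one_mul]

lemma labelExp_mul_of_indep (c : Fin n) (h : Fin k → ℝ) {G : (Fin n → Fin k) → ℝ}
    (hG : ∀ x j, G (Function.update x c j) = G x) :
    M.labelExp (fun x => h (x c) * G x) = (∑ i, M.p i * h i) * M.labelExp G := by
  rw [← M.labelExp_average c, ← labelExp_const_mul]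
  congr 1; ext x
  simp only [Function.update_self, hG, Finset.sum_mul, mul_assoc]

/-- Given the label of the centre, the leaf labels are independent and each integrates to the row
mean. The spectator factor `G` makes the induction close: it absorbs each row mean as it is
produced. -/
lemma labelExp_prod_leaves {c : Fin n} {A : Finset (Fin n)} (hc : c ∉ A)
    {G : (Fin n → Fin k) → ℝ} (hG : ∀ w ∈ A, ∀ x j, G (Function.update x w j) = G x) :
    M.labelExp (fun x => (∏ w ∈ A, M.Q (x c) (x w)) * G x) =
      M.labelExp (fun x => M.rowMean (x c) ^ A.card * G x) := by
  induction A using Finset.induction_on generalizing G with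
  | empty => simp
  | insert a A ha ih =>
    simp only [Finset.mem_insert, not_or] at hc
    have h1 : ∀ x : Fin n → Fin k, ∀ j, Function.update x a j c = x c := fun x j =>
      Function.update_of_ne hc.1 _ _
    rw [← M.labelExp_average a]
    have h2 : ∀ x : Fin n → Fin k, ∀ j,
        ∏ w ∈ A, M.Q (x c) (Function.update x a j w) = ∏ w ∈ A, M.Q (x c) (x w) := fun x j =>
      Finset.prod_congr rfl fun w hw => by
        rw [Function.update_of_ne (by rintro rfl; exact ha hw)]
    simp only [Finset.prod_insert ha, h1, h2, Function.update_self,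
      hG a (Finset.mem_insert_self _ _)]
    have h4 : (fun x : Fin n → Fin k => ∑ j, M.p j *
        (M.Q (x c) j * (∏ w ∈ A, M.Q (x c) (x w)) * G x)) =
        fun x => (∏ w ∈ A, M.Q (x c) (x w)) * (M.rowMean (x c) * G x) := by
      ext x
      simp only [rowMean, Finset.sum_mul, Finset.mul_sum]
      exact Finset.sum_congr rfl fun _ _ => by ring
    rw [h4, ih hc.2]
    · congr 1; ext x; rw [Finset.card_insert_of_notMem ha]; ring
    · intro w hw x j
      rw [hG w (Finset.mem_insert_of_mem hw),
        Function.update_of_ne (by rintro rfl; exact hc.2 hw)]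

lemma coef_empty : M.coef (∅ : Finset (Sym2 (Fin n))) = 1 := by
  simp [coef, labelExp_one]

lemma prod_starEdges (c : Fin n) (A : Finset (Fin n)) (g : Sym2 (Fin n) → ℝ) :
    ∏ e ∈ starEdges c A, g e = ∏ w ∈ A, g s(c, w) := by
  rw [starEdges, Finset.prod_image]
  intro a _ b _ h
  exact Sym2.congr_right.1 h

/-- The coefficient of the disjoint union of a star and another graph. -/
lemma coef_starEdges_union {c : Fin n} {A : Finset (Fin n)} (hc : c ∉ A)
    {S : Finset (Sym2 (Fin n))} (hS : ∀ e ∈ S, ∀ v ∈ e, v ≠ c ∧ v ∉ A) :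
    M.coef (starEdges c A ∪ S) = M.moment A.card * M.coef S := by
  have hd : Disjoint (starEdges c A) S := by
    rw [Finset.disjoint_left]
    intro e he heS
    obtain ⟨w, _, rfl⟩ := Finset.mem_image.1 he
    exact (hS _ heS c (Sym2.mem_mk_left _ _)).1 rfl
  have hG : ∀ w, (w = c ∨ w ∈ A) → ∀ (x : Fin n → Fin k) j,
      ∏ e ∈ S, M.weight (Function.update x w j) e = ∏ e ∈ S, M.weight x e := by
    intro w hw x j
    refine Finset.prod_congr rfl fun e he => M.weight_update x (fun h => ?_) j
    have := hS e he w h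
    tauto
  unfold coef
  simp only [Finset.prod_union hd, prod_starEdges, weight_mk]
  rw [M.labelExp_prod_leaves hc fun w hw => hG w (Or.inr hw)]
  exact M.labelExp_mul_of_indep c (fun i => M.rowMean i ^ A.card) (hG c (Or.inl rfl))

lemma coef_starEdges {c : Fin n} {A : Finset (Fin n)} (hc : c ∉ A) :
    M.coef (starEdges c A) = M.moment A.card := by
  simpa [coef_empty] using M.coef_starEdges_union hc (S := ∅) (by simp)

variable {M}

lemma weight_nonneg (hQ : ∀ i j, 0 ≤ M.Q i j) (x : Fin n → Fin k) (e : Sym2 (Fin n)) :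
    0 ≤ M.weight x e := by
  induction e with | _ u v => exact hQ _ _

lemma coef_nonneg (hQ : ∀ i j, 0 ≤ M.Q i j) (S : Finset (Sym2 (Fin n))) : 0 ≤ M.coef S :=
  M.labelExp_nonneg fun x => Finset.prod_nonneg fun e _ => weight_nonneg hQ x e

/-- Extra edges only multiply the integrand by factors in $[0,1]$. This monotonicity allows every
pruning of edges below. -/
lemma coef_anti (hQ : ∀ i j, 0 ≤ M.Q i j) {S T : Finset (Sym2 (Fin n))} (h : S ⊆ T) :
    M.coef T ≤ M.coef S := by
  refine M.labelExp_mono fun x => ?_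
  rw [← Finset.prod_sdiff h]
  exact mul_le_of_le_one_left (Finset.prod_nonneg fun e _ => weight_nonneg hQ x e)
    (Finset.prod_le_one (fun e _ => weight_nonneg hQ x e)
      fun e _ => (le_abs_self _).trans (M.abs_weight_le x e))

lemma rowMean_nonneg (hQ : ∀ i j, 0 ≤ M.Q i j) (i : Fin k) : 0 ≤ M.rowMean i :=
  Finset.sum_nonneg fun j _ => mul_nonneg (M.p_nonneg j) (hQ i j)

lemma moment_nonneg (hQ : ∀ i j, 0 ≤ M.Q i j) (t : ℕ) : 0 ≤ M.moment t :=
  Finset.sum_nonneg fun i _ => mul_nonneg (M.p_nonneg i) (pow_nonneg (rowMean_nonneg hQ i) t)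

/-- Moments of order below `t` are controlled by the one of order `t`. -/
lemma pow_mul_moment_le (hQ : ∀ i j, 0 ≤ M.Q i j) {a t : ℕ} (h : a ≤ t) {s : ℝ} (hs : 0 ≤ s) :
    s ^ a * M.moment a ≤ 1 + s ^ t * M.moment t := by
  have h1 : 1 + s ^ t * M.moment t = ∑ i, M.p i * (1 + (s * M.rowMean i) ^ t) := by
    simp only [moment, mul_add, Finset.sum_add_distrib, mul_one, M.p_sum, Finset.mul_sum, mul_pow]
    congr 1
    exact Finset.sum_congr rfl fun _ _ => by ring
  rw [h1, moment, Finset.mul_sum]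
  refine Finset.sum_le_sum fun i _ => ?_
  have h2 : 0 ≤ s * M.rowMean i := mul_nonneg hs (rowMean_nonneg hQ i)
  -- Pointwise, $y^a\le 1+y^t$ for $y\ge 0$ and $a\le t$; averaging over labels gives the claim.
  have h3 : (s * M.rowMean i) ^ a ≤ 1 + (s * M.rowMean i) ^ t := by
    rcases le_total (s * M.rowMean i) 1 with h | h'
    · exact (pow_le_one₀ h2 h).trans (by linarith [pow_nonneg h2 t])
    · exact (pow_le_pow_right₀ h' h).trans (by linarith)
  calc s ^ a * (M.p i * M.rowMean i ^ a) = M.p i * (s * M.rowMean i) ^ a := by rw [mul_pow]; ring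
    _ ≤ _ := mul_le_mul_of_nonneg_left h3 (M.p_nonneg i)

/-- If no label is rare, the even moments are controlled by the squares of moments. -/
lemma moment_two_mul_le (hQ : ∀ i j, 0 ≤ M.Q i j) {q : ℝ} (hp : ∀ i, 0 < M.p i → q ≤ M.p i)
    (t : ℕ) : q * M.moment (2 * t) ≤ M.moment t ^ 2 := by
  have h0 : ∀ i, 0 ≤ M.p i * M.rowMean i ^ t := fun i =>
    mul_nonneg (M.p_nonneg i) (pow_nonneg (rowMean_nonneg hQ i) t)
  -- The square of the sum dominates the sum of the squares $p_i^2 r_i^{2t}$, and one factor $p_i$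
  -- of each is at least $q$.
  refine le_trans ?_ (Finset.sum_sq_le_sq_sum_of_nonneg fun i _ => h0 i)
  rw [moment, Finset.mul_sum]
  refine Finset.sum_le_sum fun i _ => ?_
  rcases (M.p_nonneg i).eq_or_lt with h | h
  · simp [← h]
  · have := mul_le_mul_of_nonneg_right (hp i h)
      (mul_nonneg h.le (pow_nonneg (rowMean_nonneg hQ i) (2 * t)))
    calc _ ≤ _ := this
      _ = _ := by ring

end SBM

/-! ### Characters and the Fourier coefficients of both laws. -/

open scoped Classical in
/-- The sign `±1` recording whether `e` is an edge of `G`. -/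
def edgeSign {n : ℕ} (G : SimpleGraph (Fin n)) (e : Sym2 (Fin n)) : ℝ :=
  if e ∈ G.edgeSet then 1 else -1

lemma edgeSign_of_mem {n : ℕ} {G : SimpleGraph (Fin n)} {e : Sym2 (Fin n)} (h : e ∈ G.edgeSet) :
    edgeSign G e = 1 := if_pos h

lemma edgeSign_of_notMem {n : ℕ} {G : SimpleGraph (Fin n)} {e : Sym2 (Fin n)}
    (h : e ∉ G.edgeSet) : edgeSign G e = -1 := if_neg h

/-- The character (Fourier basis function) with index `S`. -/
def edgeChar {n : ℕ} (S : Finset (Sym2 (Fin n))) (G : SimpleGraph (Fin n)) : ℝ :=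
  ∏ e ∈ S, edgeSign G e

/-- The edges of the complete graph. -/
def pairs (n : ℕ) : Finset (Sym2 (Fin n)) := {e | ¬ e.IsDiag}

lemma mem_pairs {n : ℕ} {e : Sym2 (Fin n)} : e ∈ pairs n ↔ ¬ e.IsDiag := by simp [pairs]

lemma starEdges_subset_pairs {n : ℕ} {c : Fin n} {A : Finset (Fin n)} (hc : c ∉ A) :
    starEdges c A ⊆ pairs n := by
  intro e he
  obtain ⟨w, hw, rfl⟩ := Finset.mem_image.1 he
  rw [mem_pairs, Sym2.mk_isDiag_iff]
  rintro rfl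
  exact hc hw

lemma prod_lt_eq_prod_pairs {n : ℕ} (g : Sym2 (Fin n) → ℝ) :
    ∏ e : Fin n × Fin n with e.1 < e.2, g s(e.1, e.2) = ∏ e ∈ pairs n, g e := by
  refine Finset.prod_bij (fun e _ => s(e.1, e.2)) ?_ ?_ ?_ fun _ _ => rfl
  · intro e he
    simp only [Finset.mem_filter_univ] at he
    rw [mem_pairs, Sym2.mk_isDiag_iff]
    exact he.ne
  · intro a ha b hb h
    simp only [Finset.mem_filter_univ] at ha hb
    rcases Sym2.eq_iff.1 h with ⟨h1, h2⟩ | ⟨h1, h2⟩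
    · exact Prod.ext h1 h2
    · rw [h1, h2] at ha
      exact absurd ha hb.asymm
  · intro e he
    induction e with
    | _ u v =>
      rw [mem_pairs, Sym2.mk_isDiag_iff] at he
      rcases lt_or_gt_of_ne he with h | h
      · exact ⟨(u, v), by simpa using h, rfl⟩
      · exact ⟨(v, u), by simpa using h, Sym2.eq_swap⟩

-- Expanding the product on the right chooses, for each pair, edge or non-edge, which is the same as
-- choosing a graph.
open scoped Classical in
lemma sum_graph_prod {n : ℕ} (a b : Sym2 (Fin n) → ℝ) :
    ∑ G : SimpleGraph (Fin n), ∏ e ∈ pairs n, (if e ∈ G.edgeSet then a e else b e) =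
      ∏ e ∈ pairs n, (a e + b e) := by
  rw [Finset.prod_add]
  refine Finset.sum_bij' (fun G _ => (pairs n).filter (· ∈ G.edgeSet))
    (fun T _ => SimpleGraph.fromEdgeSet (T : Set (Sym2 (Fin n)))) ?_ ?_ ?_ ?_ ?_
  · intro G _
    simp
  · intro T _
    simp
  · intro G _
    rw [← SimpleGraph.edgeSet_inj]
    ext e
    have : e ∈ G.edgeSet → ¬ e.IsDiag := G.not_isDiag_of_mem_edgeSet
    simp [mem_pairs]
    tauto
  · intro T hT
    ext e
    have h : e ∈ T → ¬ e.IsDiag := fun h => mem_pairs.1 (Finset.mem_powerset.1 hT h)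
    simp [mem_pairs]
    tauto
  · intro G _
    rw [Finset.prod_ite, Finset.filter_not]

/-- The Fourier coefficients of the law of the block model. -/
lemma SBM.graphExp_edgeChar {k : ℕ} (M : SBM k) {n : ℕ} {S : Finset (Sym2 (Fin n))}
    (hS : S ⊆ pairs n) : graphExp (M.law n) (edgeChar S) = M.coef S := by
  classical
  have h1 : ∀ G : SimpleGraph (Fin n), edgeChar S G =
      ∏ e ∈ pairs n, if e ∈ S then edgeSign G e else 1 := by
    intro G
    rw [Finset.prod_ite_mem, Finset.inter_eq_right.2 hS, edgeChar]
  have h2 : ∀ G : SimpleGraph (Fin n), M.law n G = M.labelExp fun x => ∏ e ∈ pairs n,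
      if e ∈ G.edgeSet then (1 + M.weight x e) / 2 else (1 - M.weight x e) / 2 := by
    intro G
    refine Finset.sum_congr rfl fun x _ => ?_
    beta_reduce
    rw [← prod_lt_eq_prod_pairs]
    congr 1
  unfold graphExp
  have h3 : ∀ G : SimpleGraph (Fin n), M.law n G * edgeChar S G =
      ∑ x : Fin n → Fin k, (∏ v, M.p (x v)) * ∏ e ∈ pairs n, if e ∈ G.edgeSet then
        (1 + M.weight x e) / 2 * (if e ∈ S then 1 else 1) else
        (1 - M.weight x e) / 2 * (if e ∈ S then -1 else 1) := by
    intro G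
    rw [h1, h2, labelExp, Finset.sum_mul]
    refine Finset.sum_congr rfl fun x _ => ?_
    rw [mul_assoc, ← Finset.prod_mul_distrib]
    congr 1
    refine Finset.prod_congr rfl fun e _ => ?_
    unfold edgeSign
    split_ifs <;> rfl
  rw [Finset.sum_congr rfl fun G _ => h3 G, Finset.sum_comm, coef, labelExp]
  refine Finset.sum_congr rfl fun x _ => ?_
  -- Each pair now contributes $\frac{1+w}2-\frac{1-w}2=w$ if it lies in `S`, and
  -- $\frac{1+w}2+\frac{1-w}2=1$ otherwise.
  rw [← Finset.mul_sum, sum_graph_prod]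
  congr 1
  rw [← Finset.inter_eq_right.2 hS, ← Finset.prod_ite_mem]
  refine Finset.prod_congr rfl fun e _ => ?_
  split_ifs with h h' h'
  · ring
  · exact absurd (by simpa [Finset.inter_eq_right.2 hS] using h) h'
  · exact absurd (by simpa [Finset.inter_eq_right.2 hS] using h') h
  · ring

/-- The block model without signal. -/
def SBM.null : SBM 1 where
  p _ := 1
  Q _ _ := 0
  p_nonneg _ := zero_le_one
  p_sum := by simp
  Q_symm _ _ := rfl
  Q_abs_le _ _ := by simp

lemma card_pairs (n : ℕ) : (pairs n).card = n.choose 2 := by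
  have := Sym2.card_subtype_not_diag (α := Fin n)
  rw [Fintype.card_fin, Fintype.card_subtype] at this
  exact this

/-- Viewing the null law as a block model lets every mean and variance computation serve both laws.
-/
lemma SBM.law_null (n : ℕ) : SBM.null.law n = erdosRenyiHalf n := by
  classical
  ext G
  unfold SBM.law erdosRenyiHalf
  have h := prod_lt_eq_prod_pairs (n := n) fun _ => (1 / 2 : ℝ)
  rw [Finset.prod_const, Finset.prod_const, card_pairs] at h
  simpa [SBM.null] using h

lemma SBM.coef_null {n : ℕ} (S : Finset (Sym2 (Fin n))) :
    SBM.null.coef S = if S = ∅ then 1 else 0 := by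
  split_ifs with h
  · rw [h, coef_empty]
  · obtain ⟨e, he⟩ := Finset.nonempty_iff_ne_empty.2 h
    have : ∀ x : Fin n → Fin 1, ∏ e ∈ S, SBM.null.weight x e = 0 := fun x =>
      Finset.prod_eq_zero he (by induction e with | _ u v => rfl)
    simp [coef, labelExp, this]

lemma edgeSign_mul_self {n : ℕ} (G : SimpleGraph (Fin n)) (e : Sym2 (Fin n)) :
    edgeSign G e * edgeSign G e = 1 := by
  unfold edgeSign; split_ifs <;> norm_num

lemma edgeChar_mul {n : ℕ} (S T : Finset (Sym2 (Fin n))) (G : SimpleGraph (Fin n)) :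
    edgeChar S G * edgeChar T G = edgeChar (symmDiff S T) G := by
  unfold edgeChar
  rw [← Finset.prod_inter_mul_prod_sdiff S T, ← Finset.prod_inter_mul_prod_sdiff T S,
    Finset.inter_comm T S, symmDiff, Finset.sup_eq_union,
    Finset.prod_union disjoint_sdiff_sdiff]
  have : (∏ e ∈ S ∩ T, edgeSign G e) * ∏ e ∈ S ∩ T, edgeSign G e = 1 := by
    rw [← Finset.prod_mul_distrib]
    exact Finset.prod_eq_one fun e _ => edgeSign_mul_self G e
  linear_combination (∏ e ∈ S \ T, edgeSign G e) * (∏ e ∈ T \ S, edgeSign G e) * this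

section graphExp

variable {n : ℕ} (w : SimpleGraph (Fin n) → ℝ)

lemma graphExp_sum {ι : Type*} (s : Finset ι) (f : ι → SimpleGraph (Fin n) → ℝ) :
    graphExp w (fun G => ∑ i ∈ s, f i G) = ∑ i ∈ s, graphExp w (f i) := by
  simp only [graphExp, Finset.mul_sum]
  exact Finset.sum_comm

lemma graphExp_const_mul (a : ℝ) (f : SimpleGraph (Fin n) → ℝ) :
    graphExp w (fun G => a * f G) = a * graphExp w f := by
  simp only [graphExp, Finset.mul_sum]
  exact Finset.sum_congr rfl fun _ _ => by ring

lemma graphExp_add (f g : SimpleGraph (Fin n) → ℝ) :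
    graphExp w (fun G => f G + g G) = graphExp w f + graphExp w g := by
  simp only [graphExp, mul_add, Finset.sum_add_distrib]

lemma graphVar_eq {w : SimpleGraph (Fin n) → ℝ} (hw : graphExp w (fun _ => 1) = 1)
    (f : SimpleGraph (Fin n) → ℝ) :
    graphVar w f = graphExp w (fun G => f G ^ 2) - graphExp w f ^ 2 := by
  set μ := graphExp w f with hμ
  have h : (fun G => (f G - μ) ^ 2) = fun G => f G ^ 2 + ((-2 * μ) * f G + μ ^ 2 * 1) := by
    ext G; ring
  rw [graphVar, ← hμ, h, graphExp_add, graphExp_add, graphExp_const_mul,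
    graphExp_const_mul, hw, ← hμ]
  ring

lemma graphVar_const_mul (a : ℝ) (f : SimpleGraph (Fin n) → ℝ) :
    graphVar w (fun G => a * f G) = a ^ 2 * graphVar w f := by
  have h := graphExp_const_mul w a f
  simp only [graphVar, h]
  rw [← graphExp_const_mul w (a ^ 2)]
  exact congrArg (graphExp w) (funext fun G => by ring)

end graphExp

lemma SBM.graphExp_one {k : ℕ} (M : SBM k) (n : ℕ) :
    graphExp (M.law n) (fun _ => 1) = 1 := by
  have := M.graphExp_edgeChar (Finset.empty_subset (pairs n))
  rw [coef_empty] at this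
  refine Eq.trans ?_ this
  exact congrArg (graphExp _) (funext fun G => by simp [edgeChar])

/-! ### Low-degree tests and the second-moment bound on their advantage. -/

/-- Nonempty edge sets with at most `D` edges. -/
def lowDegree (n D : ℕ) : Finset (Finset (Sym2 (Fin n))) :=
  {S ∈ (pairs n).powerset | S.card ≤ D ∧ S ≠ ∅}

lemma mem_lowDegree {n D : ℕ} {S : Finset (Sym2 (Fin n))} :
    S ∈ lowDegree n D ↔ S ⊆ pairs n ∧ S.card ≤ D ∧ S ≠ ∅ := by
  simp [lowDegree]

/-- The span of the characters of degree at most `D`. -/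
def charSpan (n D : ℕ) : Submodule ℝ (SimpleGraph (Fin n) → ℝ) :=
  Submodule.span ℝ (edgeChar '' {S | S ⊆ pairs n ∧ S.card ≤ D})

lemma edgeChar_mem_charSpan {n D : ℕ} {S : Finset (Sym2 (Fin n))} (hS : S ⊆ pairs n)
    (hD : S.card ≤ D) : edgeChar S ∈ charSpan n D :=
  Submodule.subset_span ⟨S, ⟨hS, hD⟩, rfl⟩

lemma prod_indicator_mem_charSpan {n D : ℕ} {T : Finset (Sym2 (Fin n))} (hT : T ⊆ pairs n)
    (hD : T.card ≤ D) :
    (fun G => ∏ e ∈ T, (edgeSign G e / 2 + 1 / 2)) ∈ charSpan n D := by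
  have h : (fun G => ∏ e ∈ T, (edgeSign G e / 2 + 1 / 2)) =
      ∑ U ∈ T.powerset, ((1 / 2 : ℝ) ^ U.card * (1 / 2) ^ (T \ U).card) • edgeChar U := by
    ext G
    rw [Finset.prod_add, Finset.sum_apply]
    refine Finset.sum_congr rfl fun U _ => ?_
    simp only [div_eq_mul_inv, Finset.prod_mul_distrib, Finset.prod_const, edgeChar,
      Pi.smul_apply, smul_eq_mul, one_mul]
    ring
  rw [h]
  refine Submodule.sum_mem _ fun U hU => Submodule.smul_mem _ _ ?_
  have hU := Finset.mem_powerset.1 hU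
  exact edgeChar_mem_charSpan (hU.trans hT) ((Finset.card_le_card hU).trans hD)

/-- Edge indicators are idempotent, so a monomial depends only on its support; each indicator is
$(\text{sign}+1)/2$. -/
lemma IsDegreeLE.mem_charSpan {n D : ℕ} {f : SimpleGraph (Fin n) → ℝ} (hf : IsDegreeLE D f) :
    f ∈ charSpan n D := by
  classical
  obtain ⟨P, hP, hf⟩ := hf
  have h : f = ∑ m ∈ P.support, P.coeff m • fun G =>
      ∏ e ∈ m.support.map (Function.Embedding.subtype _), (edgeSign G e / 2 + 1 / 2) := by
    ext G
    rw [hf, MvPolynomial.eval_eq, Finset.sum_apply]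
    refine Finset.sum_congr rfl fun m _ => ?_
    rw [Pi.smul_apply, smul_eq_mul, Finset.prod_map]
    congr 1
    refine Finset.prod_congr rfl fun e he => ?_
    have he := Finsupp.mem_support_iff.1 he
    change _ = edgeSign G e.1 / 2 + 1 / 2
    by_cases h : (e : Sym2 (Fin n)) ∈ G.edgeSet
    · rw [if_pos h, edgeSign_of_mem h]
      norm_num
    · rw [if_neg h, edgeSign_of_notMem h]
      norm_num [he]
  rw [h]
  refine Submodule.sum_mem _ fun m hm => Submodule.smul_mem _ _ ?_
  refine prod_indicator_mem_charSpan ?_ ?_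
  · intro e he
    obtain ⟨e', _, rfl⟩ := Finset.mem_map.1 he
    exact mem_pairs.2 (SimpleGraph.not_isDiag_of_mem_edgeSet _ e'.2)
  · rw [Finset.card_map]
    refine le_trans ?_ ((MvPolynomial.le_totalDegree hm).trans hP)
    rw [Finset.card_eq_sum_ones, Finsupp.sum]
    exact Finset.sum_le_sum fun e he => Nat.one_le_iff_ne_zero.2 (Finsupp.mem_support_iff.1 he)

lemma graphExp_erdosRenyiHalf_edgeChar {n : ℕ} {S : Finset (Sym2 (Fin n))} (hS : S ⊆ pairs n) :
    graphExp (erdosRenyiHalf n) (edgeChar S) = if S = ∅ then 1 else 0 := by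
  rw [← SBM.law_null, SBM.null.graphExp_edgeChar hS, SBM.coef_null]

lemma symmDiff_subset_pairs {n : ℕ} {S T : Finset (Sym2 (Fin n))} (hS : S ⊆ pairs n)
    (hT : T ⊆ pairs n) : symmDiff S T ⊆ pairs n := by
  intro e he
  rcases Finset.mem_symmDiff.1 he with h | h
  exacts [hS h.1, hT h.1]

/-- The low-degree part of the likelihood ratio, without its constant term. -/
def SBM.lowDegreeRatio {k : ℕ} (M : SBM k) (n D : ℕ) (G : SimpleGraph (Fin n)) : ℝ :=
  ∑ S ∈ lowDegree n D, M.coef S * edgeChar S G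

/-- By linearity it suffices to test characters, where orthonormality picks out one coefficient. The
empty character has mean 1 under both laws, which is why the ratio omits it. -/
lemma SBM.graphExp_sub_eq {k : ℕ} (M : SBM k) {n D : ℕ} {f : SimpleGraph (Fin n) → ℝ}
    (hf : f ∈ charSpan n D) :
    graphExp (M.law n) f - graphExp (erdosRenyiHalf n) f =
      graphExp (erdosRenyiHalf n) (fun G => f G * M.lowDegreeRatio n D G) := by
  induction hf using Submodule.span_induction with
  | mem f hf =>
    obtain ⟨T, ⟨hT, hD⟩, rfl⟩ := hf
    rw [M.graphExp_edgeChar hT, graphExp_erdosRenyiHalf_edgeChar hT]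
    have h : (fun G => edgeChar T G * M.lowDegreeRatio n D G) = fun G =>
        ∑ S ∈ lowDegree n D, M.coef S * edgeChar (symmDiff T S) G := by
      ext G
      rw [lowDegreeRatio, Finset.mul_sum]
      refine Finset.sum_congr rfl fun S _ => ?_
      rw [← edgeChar_mul]; ring
    rw [h, graphExp_sum]
    have h2 : ∀ S ∈ lowDegree n D, graphExp (erdosRenyiHalf n)
        (fun G => M.coef S * edgeChar (symmDiff T S) G) = if T = S then M.coef S else 0 := by
      intro S hS
      rw [graphExp_const_mul, graphExp_erdosRenyiHalf_edgeChar
        (symmDiff_subset_pairs hT (mem_lowDegree.1 hS).1)]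
      simp only [← Finset.bot_eq_empty, symmDiff_eq_bot]
      split_ifs <;> simp
    rw [Finset.sum_congr rfl h2, Finset.sum_ite_eq]
    by_cases h0 : T = ∅
    · simp [h0, mem_lowDegree, coef_empty]
    · simp [h0, mem_lowDegree, hT, hD]
  | zero => simp [graphExp]
  | add f g _ _ hf hg =>
    have h : (fun G => (f + g) G * M.lowDegreeRatio n D G) = fun G =>
      f G * M.lowDegreeRatio n D G + g G * M.lowDegreeRatio n D G := by
      ext G; rw [Pi.add_apply, add_mul]
    have h' : ∀ w, graphExp w (f + g) = graphExp w f + graphExp w g := fun w => graphExp_add w f g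
    rw [h, graphExp_add, ← hf, ← hg, h', h']
    ring
  | smul a f _ hf =>
    have h : (fun G => (a • f) G * M.lowDegreeRatio n D G) = fun G =>
      a * (f G * M.lowDegreeRatio n D G) := by
      ext G; rw [Pi.smul_apply, smul_eq_mul, mul_assoc]
    have h' : ∀ w, graphExp w (a • f) = a * graphExp w f := fun w => graphExp_const_mul w a f
    rw [h, graphExp_const_mul, ← hf, h', h']
    ring

lemma SBM.graphExp_null_lowDegreeRatio {k : ℕ} (M : SBM k) (n D : ℕ) :
    graphExp (erdosRenyiHalf n) (M.lowDegreeRatio n D) = 0 := by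
  have h : graphExp (erdosRenyiHalf n) (M.lowDegreeRatio n D) = ∑ S ∈ lowDegree n D,
    graphExp (erdosRenyiHalf n) (fun G => M.coef S * edgeChar S G) := graphExp_sum _ _ _
  rw [h]
  refine Finset.sum_eq_zero fun S hS => ?_
  obtain ⟨h1, _, h2⟩ := mem_lowDegree.1 hS
  rw [graphExp_const_mul, graphExp_erdosRenyiHalf_edgeChar h1, if_neg h2, mul_zero]

lemma SBM.graphExp_lowDegreeRatio {k : ℕ} (M : SBM k) (n D : ℕ) :
    graphExp (M.law n) (M.lowDegreeRatio n D) = ∑ S ∈ lowDegree n D, M.coef S ^ 2 := by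
  have h : graphExp (M.law n) (M.lowDegreeRatio n D) = ∑ S ∈ lowDegree n D,
    graphExp (M.law n) (fun G => M.coef S * edgeChar S G) := graphExp_sum _ _ _
  rw [h]
  refine Finset.sum_congr rfl fun S hS => ?_
  rw [graphExp_const_mul, M.graphExp_edgeChar (mem_lowDegree.1 hS).1, sq]

lemma SBM.lowDegreeRatio_mem {k : ℕ} (M : SBM k) (n D : ℕ) :
    M.lowDegreeRatio n D ∈ charSpan n D := by
  have h : M.lowDegreeRatio n D = ∑ S ∈ lowDegree n D, M.coef S • edgeChar S := by
    ext G; simp [lowDegreeRatio]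
  rw [h]
  refine Submodule.sum_mem _ fun S hS => Submodule.smul_mem _ _ ?_
  obtain ⟨h1, h2, _⟩ := mem_lowDegree.1 hS
  exact edgeChar_mem_charSpan h1 h2

lemma graphExp_erdosRenyiHalf_mul_sq_le {n : ℕ} (f g : SimpleGraph (Fin n) → ℝ) :
    graphExp (erdosRenyiHalf n) (fun G => f G * g G) ^ 2 ≤
      graphExp (erdosRenyiHalf n) (fun G => f G ^ 2) *
        graphExp (erdosRenyiHalf n) (fun G => g G ^ 2) := by
  simp only [graphExp, erdosRenyiHalf, ← Finset.mul_sum]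
  rw [mul_pow, sq, mul_mul_mul_comm]
  exact mul_le_mul_of_nonneg_left (Finset.sum_mul_sq_le_sq_mul_sq _ _ _) (by positivity)

/-- The advantage of a low-degree test is bounded by the low-degree second moment. -/
lemma SBM.sq_graphExp_sub_le {k : ℕ} (M : SBM k) {n D : ℕ} {f : SimpleGraph (Fin n) → ℝ}
    (hf : f ∈ charSpan n D) :
    (graphExp (M.law n) f - graphExp (erdosRenyiHalf n) f) ^ 2 ≤
      graphVar (erdosRenyiHalf n) f * ∑ S ∈ lowDegree n D, M.coef S ^ 2 := by
  -- Taking the ratio itself as the test identifies its null second moment with the sum of squared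
  -- coefficients.
  have h1 := M.graphExp_sub_eq (M.lowDegreeRatio_mem n D)
  rw [graphExp_null_lowDegreeRatio, graphExp_lowDegreeRatio, sub_zero] at h1
  have h2 : graphExp (erdosRenyiHalf n) (fun G => f G * M.lowDegreeRatio n D G) =
      graphExp (erdosRenyiHalf n)
        (fun G => (f G - graphExp (erdosRenyiHalf n) f) * M.lowDegreeRatio n D G) := by
    have h : ∀ G, f G * M.lowDegreeRatio n D G =
      (f G - graphExp (erdosRenyiHalf n) f) * M.lowDegreeRatio n D G +
        graphExp (erdosRenyiHalf n) f * M.lowDegreeRatio n D G := fun G => by ring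
    rw [funext h, graphExp_add, graphExp_const_mul]
    erw [graphExp_null_lowDegreeRatio]
    ring
  rw [M.graphExp_sub_eq hf, h2, h1]
  refine (graphExp_erdosRenyiHalf_mul_sq_le _ _).trans_eq ?_
  simp only [graphVar, sq]

/-! ### Star coefficients control all low-degree coefficients. -/

/-- The vertices covered by a set of edges. -/
def edgeSupport {n : ℕ} (S : Finset (Sym2 (Fin n))) : Finset (Fin n) := {v | ∃ e ∈ S, v ∈ e}

lemma mem_edgeSupport {n : ℕ} {S : Finset (Sym2 (Fin n))} {v : Fin n} :
    v ∈ edgeSupport S ↔ ∃ e ∈ S, v ∈ e := by simp [edgeSupport]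

lemma card_starEdges {n : ℕ} (c : Fin n) (A : Finset (Fin n)) :
    (starEdges c A).card = A.card :=
  Finset.card_image_of_injective _ fun _ _ h => Sym2.congr_right.1 h

/-- A graph either has an edge whose removal leaves no new isolated vertices,
or one of its components is a star. -/
lemma exists_redundant_or_star {n : ℕ} {S : Finset (Sym2 (Fin n))} (hS : S ⊆ pairs n)
    (h0 : S ≠ ∅) :
    (∃ e ∈ S, edgeSupport (S.erase e) = edgeSupport S) ∨
    ∃ (c : Fin n) (A : Finset (Fin n)), c ∉ A ∧ A.Nonempty ∧ ∃ T ⊂ S, S = starEdges c A ∪ T ∧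
      ∀ e ∈ T, ∀ v ∈ e, v ≠ c ∧ v ∉ A := by
  by_cases h : ∃ e ∈ S, edgeSupport (S.erase e) = edgeSupport S
  · exact Or.inl h
  right
  -- With no redundant edge, every edge has an endpoint of degree one; otherwise erasing it would
  -- uncover nothing.
  have hex : ∀ e ∈ S, ∃ v ∈ e, ∀ e' ∈ S, v ∈ e' → e' = e := by
    intro e he
    by_contra! hcon
    refine h ⟨e, he, ?_⟩
    ext v
    simp only [mem_edgeSupport, Finset.mem_erase]
    constructor
    · rintro ⟨e', ⟨_, h2⟩, h3⟩
      exact ⟨e', h2, h3⟩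
    · rintro ⟨e', h2, h3⟩
      by_cases hee : e' = e
      · subst hee
        obtain ⟨e'', h4, h5, h6⟩ := hcon v h3
        exact ⟨e'', ⟨h6, h4⟩, h5⟩
      · exact ⟨e', ⟨hee, h2⟩, h3⟩
  obtain ⟨e, he⟩ := Finset.nonempty_iff_ne_empty.2 h0
  obtain ⟨u, hue, hu⟩ := hex e he
  -- `u` is a degree-one endpoint; all edges at the opposite endpoint `c` form the star.
  obtain ⟨c, rfl⟩ := Sym2.mem_iff_exists.1 hue
  have hcA : ∀ w, s(c, w) ∈ S → c ≠ w := by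
    intro w hw
    have := mem_pairs.1 (hS hw)
    rwa [Sym2.mk_isDiag_iff] at this
  have huS : s(c, u) ∈ S := by rwa [Sym2.eq_swap]
  have hstar : starEdges c {w | s(c, w) ∈ S} ⊆ S := by
    intro e' he'
    obtain ⟨w, hw, rfl⟩ := Finset.mem_image.1 he'
    simpa using hw
  refine ⟨c, Finset.univ.filter fun w => s(c, w) ∈ S, ?_, ⟨u, by simpa using huS⟩,
    S \ starEdges c {w | s(c, w) ∈ S}, ?_, ?_, ?_⟩
  · intro hc
    exact hcA c (by simpa using hc) rfl
  · refine Finset.sdiff_ssubset hstar ⟨s(c, u), Finset.mem_image_of_mem _ (by simpa using huS)⟩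
  · rw [Finset.union_sdiff_of_subset hstar]
  · intro e' he' v hv
    obtain ⟨h1, h2⟩ := Finset.mem_sdiff.1 he'
    have hvc : v ≠ c := by
      rintro rfl
      obtain ⟨w, rfl⟩ := Sym2.mem_iff_exists.1 hv
      exact h2 (Finset.mem_image_of_mem _ (by simpa using h1))
    refine ⟨hvc, fun hvA => ?_⟩
    have hvS : s(c, v) ∈ S := by simpa using hvA
    have hne : e' ≠ s(c, v) := by
      rintro rfl
      exact h2 (Finset.mem_image_of_mem _ hvA)
    -- If the degree-one endpoint of $cv$ is `c`, then $v=u$, which already has degree one; if it is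
    -- `v`, no second edge meets `v`. Both exclude `e'`.
    obtain ⟨y, hy, hy'⟩ := hex _ hvS
    rcases Sym2.mem_iff.1 hy with rfl | rfl
    · have := hy' _ huS (Sym2.mem_mk_left _ _)
      have huv : u = v := Sym2.congr_right.1 this
      subst huv
      exact hne ((hu e' h1 hv).trans Sym2.eq_swap)
    · exact hne (hy' e' h1 hv)

lemma edgeSupport_starEdges_union {n : ℕ} {c : Fin n} {A : Finset (Fin n)} (hA : A.Nonempty)
    (T : Finset (Sym2 (Fin n))) :
    edgeSupport (starEdges c A ∪ T) = insert c A ∪ edgeSupport T := by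
  ext v
  simp only [mem_edgeSupport, Finset.mem_union, Finset.mem_insert, starEdges, Finset.mem_image]
  constructor
  · rintro ⟨e, ⟨w, hw, rfl⟩ | he, hv⟩
    · rcases Sym2.mem_iff.1 hv with rfl | rfl
      · exact Or.inl (Or.inl rfl)
      · exact Or.inl (Or.inr hw)
    · exact Or.inr ⟨e, he, hv⟩
  · rintro ((rfl | hv) | ⟨e, he, hv⟩)
    · obtain ⟨w, hw⟩ := hA
      exact ⟨_, Or.inl ⟨w, hw, rfl⟩, Sym2.mem_mk_left _ _⟩
    · exact ⟨_, Or.inl ⟨v, hv, rfl⟩, Sym2.mem_mk_right _ _⟩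
    · exact ⟨e, Or.inr he, hv⟩

/-- Star coefficients control all coefficients of low degree. -/
lemma SBM.pow_mul_coef_le {k : ℕ} {M : SBM k} (hQ : ∀ i j, 0 ≤ M.Q i j) {n D : ℕ} {s B : ℝ}
    (hs : 0 ≤ s) (hB : 1 ≤ B) (hM : ∀ t, 1 ≤ t → t ≤ D → s ^ (t + 1) * M.moment t ≤ B)
    (S : Finset (Sym2 (Fin n))) (hS : S ⊆ pairs n) (hD : S.card ≤ D) :
    s ^ (edgeSupport S).card * M.coef S ≤ B ^ (edgeSupport S).card := by
  induction S using Finset.strongInduction with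
  | H S ih =>
    by_cases h0 : S = ∅
    · subst h0
      simp [edgeSupport, coef_empty]
    rcases exists_redundant_or_star hS h0 with ⟨e, he, hes⟩ | ⟨c, A, hc, hA, T, hT, rfl, hTA⟩
    -- The support is unchanged, so the powers of `s` and `B` stay the same while the coefficient
    -- can only grow.
    · have h := ih (S.erase e) (Finset.erase_ssubset he) ((Finset.erase_subset _ _).trans hS)
        ((Finset.card_le_card (Finset.erase_subset _ _)).trans hD)
      rw [hes] at h
      exact (mul_le_mul_of_nonneg_left (coef_anti hQ (Finset.erase_subset e S))
        (pow_nonneg hs _)).trans h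
    · have h := ih T hT (hT.1.trans hS) ((Finset.card_le_card hT.1).trans hD)
      have hdis : Disjoint (insert c A) (edgeSupport T) := by
        rw [Finset.disjoint_right]
        intro v hv
        obtain ⟨e, he, hve⟩ := mem_edgeSupport.1 hv
        have := hTA e he v hve
        simpa using this
      have hAD : A.card ≤ D := by
        rw [← card_starEdges c A]
        exact (Finset.card_le_card Finset.subset_union_left).trans hD
      rw [M.coef_starEdges_union hc hTA, edgeSupport_starEdges_union hA,
        Finset.card_union_of_disjoint hdis, Finset.card_insert_of_notMem hc]
      have hB0 : 0 ≤ B := zero_le_one.trans hB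
      calc s ^ (A.card + 1 + (edgeSupport T).card) * (M.moment A.card * M.coef T)
          = (s ^ (A.card + 1) * M.moment A.card) * (s ^ (edgeSupport T).card * M.coef T) := by
            rw [pow_add]; ring
        _ ≤ B * B ^ (edgeSupport T).card :=
            mul_le_mul (hM _ hA.card_pos hAD) h
              (mul_nonneg (pow_nonneg hs _) (coef_nonneg hQ T)) hB0
        _ ≤ B ^ (A.card + 1) * B ^ (edgeSupport T).card :=
            mul_le_mul_of_nonneg_right (le_self_pow₀ hB (by omega)) (pow_nonneg hB0 _)
        _ = _ := (pow_add _ _ _).symm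

/-- Bounding a sum by sorting its terms by a set of vertices. -/
lemma sum_le_of_card_fibre_le {ι : Type*} {n m K : ℕ} (hn : 0 < n) (I : Finset ι)
    (U : ι → Finset (Fin n)) (hm : ∀ i ∈ I, (U i).card ≤ m)
    (hK : ∀ V : Finset (Fin n), V.card ≤ m → (I.filter fun i => U i = V).card ≤ K)
    {f : ι → ℝ} {b : ℝ} (hb : 0 ≤ b) (hf : ∀ i ∈ I, (n : ℝ) ^ (U i).card * f i ≤ b) :
    ∑ i ∈ I, f i ≤ (m + 1) * K * b := by
  have hn' : (0 : ℝ) < n := Nat.cast_pos.2 hn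
  have h1 : ∑ i ∈ I, f i = ∑ V : Finset (Fin n) with V.card ≤ m,
      ∑ i ∈ I with U i = V, f i := by
    rw [Finset.sum_fiberwise_of_maps_to]
    intro i hi
    simpa using hm i hi
  have h2 : ∀ V ∈ (Finset.univ : Finset (Finset (Fin n))).filter fun V => V.card ≤ m,
      ∑ i ∈ I with U i = V, f i ≤ K * b * ((n : ℝ) ^ V.card)⁻¹ := by
    intro V hV
    have hV : V.card ≤ m := by simpa using hV
    calc ∑ i ∈ I with U i = V, f i ≤ ∑ i ∈ I with U i = V, b * ((n : ℝ) ^ V.card)⁻¹ := by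
          refine Finset.sum_le_sum fun i hi => ?_
          obtain ⟨hi, hV⟩ := Finset.mem_filter.1 hi
          rw [← hV, ← div_eq_mul_inv, le_div_iff₀ (by positivity), mul_comm]
          exact hf i hi
      _ = (I.filter fun i => U i = V).card * (b * ((n : ℝ) ^ V.card)⁻¹) := by
          rw [Finset.sum_const, nsmul_eq_mul]
      _ ≤ K * (b * ((n : ℝ) ^ V.card)⁻¹) :=
          mul_le_mul_of_nonneg_right (Nat.cast_le.2 (hK V hV)) (by positivity)
      _ = _ := by ring
  -- Each size $v\le m$ contributes $\binom nv n^{-v}\le 1$.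
  have h3 : ∑ V : Finset (Fin n) with V.card ≤ m, ((n : ℝ) ^ V.card)⁻¹ ≤ m + 1 := by
    rw [← Finset.sum_fiberwise_of_maps_to (t := Finset.range (m + 1)) (g := Finset.card)
      (by intro V hV; simpa [Nat.lt_succ_iff] using hV)]
    calc _ ≤ ∑ v ∈ Finset.range (m + 1), (1 : ℝ) := ?_
      _ = m + 1 := by simp
    refine Finset.sum_le_sum fun v _ => ?_
    calc _ = ∑ V ∈ (Finset.univ.filter fun V : Finset (Fin n) => V.card ≤ m) with V.card = v,
          ((n : ℝ) ^ v)⁻¹ :=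
          Finset.sum_congr rfl fun V hV => by rw [(Finset.mem_filter.1 hV).2]
      _ ≤ ∑ V ∈ (Finset.univ : Finset (Fin n)).powersetCard v, ((n : ℝ) ^ v)⁻¹ := by
          refine Finset.sum_le_sum_of_subset_of_nonneg ?_ fun _ _ _ => by positivity
          intro V hV
          simpa [Finset.mem_powersetCard] using (Finset.mem_filter.1 hV).2
      _ = (n.choose v : ℝ) * ((n : ℝ) ^ v)⁻¹ := by
          rw [Finset.sum_const, Finset.card_powersetCard, Finset.card_fin, nsmul_eq_mul]
      _ ≤ 1 := by
          rw [← div_eq_mul_inv, div_le_one (by positivity)]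
          exact_mod_cast Nat.choose_le_pow n v
  rw [h1]
  calc _ ≤ _ := Finset.sum_le_sum h2
    _ = K * b * ∑ V : Finset (Fin n) with V.card ≤ m, ((n : ℝ) ^ V.card)⁻¹ := by
        rw [Finset.mul_sum]
    _ ≤ K * b * (m + 1) := mul_le_mul_of_nonneg_left h3 (by positivity)
    _ = _ := by ring

lemma card_edgeSupport_le {n : ℕ} (S : Finset (Sym2 (Fin n))) :
    (edgeSupport S).card ≤ 2 * S.card := by
  have h : edgeSupport S = S.biUnion fun e => Finset.univ.filter fun v => v ∈ e := by
    ext v; simp [mem_edgeSupport]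
  rw [h, mul_comm]
  refine Finset.card_biUnion_le_card_mul _ _ _ fun e _ => ?_
  induction e with
  | _ u v =>
    refine (Finset.card_le_card (t := {u, v}) ?_).trans Finset.card_le_two
    intro w hw
    simpa using hw

/-- The low-degree second moment is bounded if the normalized star coefficients are. -/
lemma SBM.sum_coef_sq_le {k : ℕ} {M : SBM k} (hQ : ∀ i j, 0 ≤ M.Q i j) {n D : ℕ} (hn : 0 < n)
    {B : ℝ} (hB : 1 ≤ B) (hM : ∀ t, 1 ≤ t → t ≤ D → √n ^ (t + 1) * M.moment t ≤ B) :
    ∑ S ∈ lowDegree n D, M.coef S ^ 2 ≤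
      ((2 * D : ℕ) + 1) * (2 ^ ((2 * D) ^ 2) : ℕ) * (B ^ (2 * D)) ^ 2 := by
  refine sum_le_of_card_fibre_le hn _ edgeSupport ?_ ?_ (by positivity) ?_
  · intro S hS
    exact (card_edgeSupport_le S).trans (Nat.mul_le_mul_left 2 (mem_lowDegree.1 hS).2.1)
  · intro V hV
    -- An edge set with support `V` is a subset of at most $|V|^2\le(2D)^2$ pairs.
    have hsub : (lowDegree n D).filter (fun S => edgeSupport S = V) ⊆
        ((V ×ˢ V).image fun a => s(a.1, a.2)).powerset := by
      intro S hS
      obtain ⟨_, rfl⟩ := Finset.mem_filter.1 hS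
      rw [Finset.mem_powerset]
      intro e he
      induction e with
      | _ u v =>
        exact Finset.mem_image.2 ⟨(u, v), Finset.mem_product.2
          ⟨mem_edgeSupport.2 ⟨_, he, Sym2.mem_mk_left _ _⟩,
            mem_edgeSupport.2 ⟨_, he, Sym2.mem_mk_right _ _⟩⟩, rfl⟩
    refine (Finset.card_le_card hsub).trans ?_
    rw [Finset.card_powerset]
    refine Nat.pow_le_pow_right (by norm_num) (Finset.card_image_le.trans ?_)
    rw [Finset.card_product, sq]
    exact Nat.mul_le_mul hV hV
  · intro S hS
    obtain ⟨h1, h2, _⟩ := mem_lowDegree.1 hS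
    have h := pow_mul_coef_le hQ (Real.sqrt_nonneg n) hB hM S h1 h2
    have h3 : B ^ (edgeSupport S).card ≤ B ^ (2 * D) := pow_le_pow_right₀ hB
      ((card_edgeSupport_le S).trans (Nat.mul_le_mul_left 2 h2))
    calc (n : ℝ) ^ (edgeSupport S).card * M.coef S ^ 2
        = (√n ^ (edgeSupport S).card * M.coef S) ^ 2 := by
          rw [mul_pow, ← pow_mul, mul_comm _ 2, pow_mul, Real.sq_sqrt (Nat.cast_nonneg n)]
      _ ≤ _ := pow_le_pow_left₀ (mul_nonneg (by positivity) (coef_nonneg hQ S)) (h.trans h3) 2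

/-! ### Signed star counts as sums over labelled stars. -/

/-- The number of labelled copies with given image is the number of automorphisms. -/
lemma card_copy_toSubgraph_eq {V W : Type*} {H : SimpleGraph W} {K : SimpleGraph V}
    {S : K.Subgraph} (hS : Nonempty (H ≃g S.coe)) :
    Nat.card {f : H.Copy K // f.toSubgraph = S} = Nat.card (H ≃g H) := by
  obtain ⟨e⟩ := hS
  -- Relative to one fixed isomorphism `e` onto `S`, labelled copies with image `S` correspond to
  -- automorphisms of `H`.
  let F : (H ≃g H) → {f : H.Copy K // f.toSubgraph = S} := fun α =>
    ⟨⟨S.hom.comp (e.comp α).toHom, SimpleGraph.Subgraph.hom_injective.comp (e.comp α).injective⟩,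
      by simp [SimpleGraph.Copy.toSubgraph, SimpleGraph.Subgraph.map_comp]⟩
  refine (Nat.card_congr (Equiv.ofBijective F ⟨?_, ?_⟩)).symm
  · intro α β h
    ext v
    have h1 : S.hom (e (α v)) = S.hom (e (β v)) :=
      congrArg (fun f : {f : H.Copy K // f.toSubgraph = S} => f.1 v) h
    exact e.injective (SimpleGraph.Subgraph.hom_injective h1)
  · rintro ⟨f, rfl⟩
    refine ⟨e.symm.comp f.isoToSubgraph, Subtype.ext (SimpleGraph.Copy.ext fun v => ?_)⟩
    change (e (e.symm (f.isoToSubgraph v))).1 = f v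
    rw [e.apply_symm_apply]
    rfl

/-- The leaves of a labelled star. -/
def leaves {t n : ℕ} (φ : Fin (t + 1) ↪ Fin n) : Finset (Fin n) :=
  Finset.univ.image fun i : Fin t => φ i.succ

/-- The edges of a labelled star. -/
def labelledStar {t n : ℕ} (φ : Fin (t + 1) ↪ Fin n) : Finset (Sym2 (Fin n)) :=
  starEdges (φ 0) (leaves φ)

lemma centre_notMem_leaves {t n : ℕ} (φ : Fin (t + 1) ↪ Fin n) : φ 0 ∉ leaves φ := by
  intro h
  obtain ⟨i, _, hi⟩ := Finset.mem_image.1 h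
  exact Fin.succ_ne_zero i (φ.injective hi)

lemma card_leaves {t n : ℕ} (φ : Fin (t + 1) ↪ Fin n) : (leaves φ).card = t := by
  rw [leaves, Finset.card_image_of_injective, Finset.card_univ, Fintype.card_fin]
  exact φ.injective.comp (Fin.succ_injective t)

lemma insert_centre_leaves {t n : ℕ} (φ : Fin (t + 1) ↪ Fin n) :
    insert (φ 0) (leaves φ) = Finset.univ.image φ := by
  ext v
  simp only [leaves, Finset.mem_insert, Finset.mem_image, Finset.mem_univ, true_and,
    Fin.exists_fin_succ, eq_comm]

lemma labelledStar_subset_pairs {t n : ℕ} (φ : Fin (t + 1) ↪ Fin n) :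
    labelledStar φ ⊆ pairs n := starEdges_subset_pairs (centre_notMem_leaves φ)

/-- The sum of the characters of all labelled stars. -/
def starSum {n : ℕ} (t : ℕ) (G : SimpleGraph (Fin n)) : ℝ :=
  ∑ φ : Fin (t + 1) ↪ Fin n, edgeChar (labelledStar φ) G

/-- Labelled copies in a complete graph are injective maps. -/
def copyEquivEmbedding (t n : ℕ) :
    (Fin (t + 1) ↪ Fin n) ≃ (starWithEdges t).Copy (⊤ : SimpleGraph (Fin n)) where
  toFun φ := ⟨⟨φ, fun {a b} h => by
    rw [SimpleGraph.top_adj]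
    exact fun hab => h.ne (φ.injective hab)⟩, φ.injective⟩
  invFun f := f.toEmbedding
  left_inv _ := rfl
  right_inv _ := rfl

lemma mem_edgeSet_copyEquivEmbedding {t n : ℕ} (φ : Fin (t + 1) ↪ Fin n) (e : Sym2 (Fin n)) :
    e ∈ (copyEquivEmbedding t n φ).toSubgraph.edgeSet ↔ e ∈ labelledStar φ := by
  simp only [labelledStar, starEdges, leaves, Finset.mem_image, Finset.mem_univ, true_and]
  induction e with
  | _ u v =>
    rw [SimpleGraph.Subgraph.mem_edgeSet, SimpleGraph.Subgraph.map_adj, Relation.map_apply]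
    constructor
    · rintro ⟨a, b, hab, rfl, rfl⟩
      have hab : (SimpleGraph.starGraph (0 : Fin (t + 1))).Adj a b := hab
      rw [SimpleGraph.starGraph_adj] at hab
      obtain ⟨hne, rfl | rfl⟩ := hab
      · obtain ⟨i, rfl⟩ := Fin.exists_succ_eq.2 hne.symm
        exact ⟨_, ⟨i, rfl⟩, rfl⟩
      · obtain ⟨i, rfl⟩ := Fin.exists_succ_eq.2 hne
        exact ⟨_, ⟨i, rfl⟩, Sym2.eq_swap⟩
    · rintro ⟨_, ⟨i, rfl⟩, h⟩
      have hi : (starWithEdges t).Adj 0 i.succ :=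
        SimpleGraph.starGraph_center_adj (Fin.succ_ne_zero i).symm
      rcases Sym2.eq_iff.1 h with ⟨rfl, rfl⟩ | ⟨rfl, rfl⟩
      · exact ⟨0, i.succ, hi, rfl, rfl⟩
      · exact ⟨i.succ, 0, hi.symm, rfl, rfl⟩

-- The factor stays an automorphism count, as it is not always $t!$: a single edge has two
-- automorphisms.
open scoped Classical in
lemma starSum_eq {t n : ℕ} (G : SimpleGraph (Fin n)) :
    starSum t G = Nat.card (starWithEdges t ≃g starWithEdges t) *
      signedCount (starWithEdges t) G := by
  have h1 : ∀ φ : Fin (t + 1) ↪ Fin n, edgeChar (labelledStar φ) G =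
      ∏ e : Sym2 (Fin n) with e ∈ (copyEquivEmbedding t n φ).toSubgraph.edgeSet,
        edgeSign G e := fun φ =>
    Finset.prod_congr (by
      ext e
      rw [Finset.mem_filter_univ, mem_edgeSet_copyEquivEmbedding]) fun _ _ => rfl
  rw [starSum, Finset.sum_congr rfl fun φ _ => h1 φ, signedCount, Finset.mul_sum,
    ← Finset.sum_fiberwise_of_maps_to
      (t := Finset.univ.filter fun S : (⊤ : SimpleGraph (Fin n)).Subgraph =>
        Nonempty (starWithEdges t ≃g S.coe))
      (g := fun φ => (copyEquivEmbedding t n φ).toSubgraph)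
      (fun φ _ => by simpa using ⟨(copyEquivEmbedding t n φ).isoToSubgraph⟩)]
  refine Finset.sum_congr rfl fun S hS => ?_
  rw [← card_copy_toSubgraph_eq (Finset.mem_filter.1 hS).2,
    ← Nat.card_congr ((copyEquivEmbedding t n).subtypeEquiv
      (p := fun φ => (copyEquivEmbedding t n φ).toSubgraph = S) fun _ => Iff.rfl),
    Nat.card_eq_fintype_card, Fintype.card_subtype, ← nsmul_eq_mul, ← Finset.sum_const]
  refine Finset.sum_congr rfl fun φ hφ => ?_
  rw [← (Finset.mem_filter.1 hφ).2]
  exact Finset.prod_congr rfl fun e _ => by unfold edgeSign; congr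

/-! ### Variance of the star count. -/

lemma starEdges_symmDiff {n : ℕ} (c : Fin n) (A A' : Finset (Fin n)) :
    symmDiff (starEdges c A) (starEdges c A') = starEdges c (symmDiff A A') :=
  (Finset.image_symmDiff _ _ fun _ _ h => Sym2.congr_right.1 h).symm

/-- The vertices of two labelled stars. -/
def jointSupport {t n : ℕ} (a : (Fin (t + 1) ↪ Fin n) × (Fin (t + 1) ↪ Fin n)) :
    Finset (Fin n) := Finset.univ.image a.1 ∪ Finset.univ.image a.2

/-- Arithmetic of two overlapping stars with different centres. -/
lemma pow_mul_mul_le {s η m x y : ℝ} {t b b' : ℕ} (hs : 1 ≤ s) (hη : 0 ≤ η) (hη1 : η ≤ 1)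
    (hm : 0 ≤ m) (hx0 : 0 ≤ x) (hy0 : 0 ≤ y) (hx : x ≤ 1 + m) (hy : y ≤ 1 + m)
    (hxt : b = t → x = m) (hyt : b' = t → y = m) (hb : b ≤ t) (hb' : b' ≤ t)
    (hbb : b + b' < 2 * t) (h : 1 + m ≤ η * s * m) :
    s ^ (4 + b + b') * (x * y) ≤ η * s ^ (2 * t + 4) * m ^ 2 := by
  have hs0 : 0 ≤ s := zero_le_one.trans hs
  by_cases hc : b = t ∨ b' = t
  -- One star is intact: the lost leaf saves a power of `s`, the exponent being at most $2t+3$, and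
  -- `h` is used once.
  · have hxy : x * y ≤ m * (1 + m) := by
      rcases hc with hc | hc
      · rw [hxt hc]
        exact mul_le_mul_of_nonneg_left hy hm
      · rw [hyt hc, mul_comm]
        exact mul_le_mul_of_nonneg_left hx hm
    calc s ^ (4 + b + b') * (x * y) ≤ s ^ (2 * t + 3) * (m * (η * s * m)) := by
          refine mul_le_mul (pow_le_pow_right₀ hs (by omega))
            (hxy.trans (mul_le_mul_of_nonneg_left h hm)) (mul_nonneg hx0 hy0) (by positivity)
      _ = _ := by ring
  -- Both stars lost a leaf: the exponent is at most $2t+2$, and `h` can be used twice.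
  · push Not at hc
    have hlt : b < t ∧ b' < t := ⟨lt_of_le_of_ne hb hc.1, lt_of_le_of_ne hb' hc.2⟩
    calc s ^ (4 + b + b') * (x * y) ≤ s ^ (2 * t + 2) * ((η * s * m) * (η * s * m)) := by
          refine mul_le_mul (pow_le_pow_right₀ hs (by omega))
            (mul_le_mul (hx.trans h) (hy.trans h) hy0 (by positivity))
            (mul_nonneg hx0 hy0) (by positivity)
      _ = η * (η * s ^ (2 * t + 4) * m ^ 2) := by ring
      _ ≤ _ := mul_le_of_le_one_left (by positivity) hη1

namespace SBM

variable {k n t : ℕ} {M : SBM k}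

/-- Vertex-disjoint stars involve independent labels, so such pairs have zero covariance. -/
lemma coef_symmDiff_of_disjoint (M : SBM k) {φ ψ : Fin (t + 1) ↪ Fin n}
    (h : Disjoint (Finset.univ.image φ) (Finset.univ.image ψ)) :
    M.coef (symmDiff (labelledStar φ) (labelledStar ψ)) =
      M.coef (labelledStar φ) * M.coef (labelledStar ψ) := by
  rw [← insert_centre_leaves, ← insert_centre_leaves] at h
  have hS : ∀ e ∈ labelledStar ψ, ∀ v ∈ e, v ≠ φ 0 ∧ v ∉ leaves φ := by
    intro e he v hv
    have hv' : v ∈ insert (ψ 0) (leaves ψ) := by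
      obtain ⟨w, hw, rfl⟩ := Finset.mem_image.1 he
      rcases Sym2.mem_iff.1 hv with rfl | rfl
      · exact Finset.mem_insert_self _ _
      · exact Finset.mem_insert_of_mem hw
    have := Finset.disjoint_right.1 h hv'
    simpa using this
  have hd : Disjoint (labelledStar φ) (labelledStar ψ) := by
    rw [Finset.disjoint_left]
    intro e he heS
    obtain ⟨w, _, rfl⟩ := Finset.mem_image.1 he
    exact (hS _ heS _ (Sym2.mem_mk_left _ _)).1 rfl
  rw [hd.symmDiff_eq_sup, Finset.sup_eq_union, labelledStar,
    M.coef_starEdges_union (centre_notMem_leaves φ) hS,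
    M.coef_starEdges (centre_notMem_leaves φ)]

/-- Overlapping pairs of stars have a small contribution to the variance. -/
lemma pow_mul_coef_symmDiff_le (hQ : ∀ i j, 0 ≤ M.Q i j) {s η : ℝ} (hs : 1 ≤ s)
    (hη : 0 ≤ η) (hη1 : η ≤ 1)
    (h1 : 1 + s ^ t * M.moment t ≤ η * s * (s ^ t * M.moment t))
    (h2 : 1 + s ^ (2 * t) * M.moment (2 * t) ≤ η * s ^ 2 * (s ^ t * M.moment t) ^ 2)
    {φ ψ : Fin (t + 1) ↪ Fin n}
    (h : ¬ Disjoint (Finset.univ.image φ) (Finset.univ.image ψ)) :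
    (s ^ 2) ^ (jointSupport (φ, ψ)).card *
      M.coef (symmDiff (labelledStar φ) (labelledStar ψ)) ≤
        η * s ^ (2 * t + 4) * (s ^ t * M.moment t) ^ 2 := by
  have hs0 : 0 ≤ s := zero_le_one.trans hs
  have hφ := centre_notMem_leaves φ
  have hψ := centre_notMem_leaves ψ
  have cφ := card_leaves φ
  have cψ := card_leaves ψ
  unfold jointSupport labelledStar
  simp only
  rw [← insert_centre_leaves, ← insert_centre_leaves] at h ⊢
  generalize leaves φ = A at *
  generalize leaves ψ = A' at *
  generalize φ 0 = c at *
  generalize ψ 0 = c' at *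
  by_cases hc : c = c'
  · subst hc
    have hcA : c ∉ symmDiff A A' := by
      rw [Finset.mem_symmDiff]; tauto
    have hcA' : c ∉ A ∪ A' := by
      rw [Finset.mem_union]; tauto
    rw [starEdges_symmDiff, M.coef_starEdges hcA, ← Finset.insert_union_distrib,
      Finset.card_insert_of_notMem hcA']
    have e1 := Finset.card_union_add_card_inter A A'
    have e2 : (symmDiff A A').card + (A ∩ A').card = (A ∪ A').card := by
      rw [symmDiff_eq_sup_sdiff_inf, Finset.sup_eq_union, Finset.inf_eq_inter]
      exact Finset.card_sdiff_add_card_eq_card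
        (Finset.inter_subset_left.trans Finset.subset_union_left)
    -- From $|A\cup A'|+|A\cap A'|=2t$ and $|A\triangle A'|+|A\cap A'|=|A\cup A'|$.
    have e3 : 2 * ((A ∪ A').card + 1) = (2 * t + 2) + (symmDiff A A').card := by omega
    rw [← pow_mul, e3]
    calc s ^ (2 * t + 2 + (symmDiff A A').card) * M.moment (symmDiff A A').card
        = s ^ (2 * t + 2) * (s ^ (symmDiff A A').card * M.moment (symmDiff A A').card) := by
          rw [pow_add]; ring
      _ ≤ s ^ (2 * t + 2) * (η * s ^ 2 * (s ^ t * M.moment t) ^ 2) :=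
          mul_le_mul_of_nonneg_left ((pow_mul_moment_le hQ (by omega) hs0).trans h2)
            (by positivity)
      _ = _ := by ring
  -- Shared leaves are left to `c'` only, and each centre is removed from the other's leaves. This
  -- makes the stars disjoint without losing a vertex.
  · set B := A \ insert c' A' with hB
    set B' := A' \ {c} with hB'
    have hcB : c ∉ B := fun h => hφ (Finset.mem_sdiff.1 h).1
    have hcB' : c' ∉ B' := fun h => hψ (Finset.mem_sdiff.1 h).1
    have hdis : Disjoint (insert c B) (insert c' B') := by
      rw [Finset.disjoint_left]
      intro v hv hv'
      simp only [hB, hB', Finset.mem_insert, Finset.mem_sdiff, Finset.mem_singleton] at hv hv'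
      rcases hv with rfl | hv
      · rcases hv' with h | h
        · exact hc h
        · exact h.2 rfl
      · tauto
    have hunion : insert c A ∪ insert c' A' = insert c B ∪ insert c' B' := by
      ext v
      simp only [hB, hB', Finset.mem_insert, Finset.mem_sdiff, Finset.mem_singleton,
        Finset.mem_union]
      tauto
    have hsub : starEdges c B ∪ starEdges c' B' ⊆ symmDiff (starEdges c A) (starEdges c' A') := by
      intro e he
      rw [Finset.mem_symmDiff]
      rcases Finset.mem_union.1 he with he | he
      · left
        obtain ⟨w, hw, rfl⟩ := Finset.mem_image.1 he
        obtain ⟨hw1, hw2⟩ := Finset.mem_sdiff.1 hw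
        refine ⟨Finset.mem_image_of_mem _ hw1, fun h => ?_⟩
        obtain ⟨w', hw', h⟩ := Finset.mem_image.1 h
        rcases Sym2.eq_iff.1 h with ⟨h, _⟩ | ⟨h, _⟩
        · exact hc h.symm
        · exact hw2 (h ▸ Finset.mem_insert_self _ _)
      · right
        obtain ⟨w, hw, rfl⟩ := Finset.mem_image.1 he
        obtain ⟨hw1, hw2⟩ := Finset.mem_sdiff.1 hw
        refine ⟨Finset.mem_image_of_mem _ hw1, fun h => ?_⟩
        obtain ⟨w', hw', h⟩ := Finset.mem_image.1 h
        rcases Sym2.eq_iff.1 h with ⟨h, _⟩ | ⟨h, _⟩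
        · exact hc h
        · exact hw2 (h ▸ Finset.mem_singleton_self _)
    have hcoef : M.coef (starEdges c B ∪ starEdges c' B') = M.moment B.card * M.moment B'.card := by
      rw [M.coef_starEdges_union hcB, M.coef_starEdges hcB']
      intro e he v hv
      have hv' : v ∈ insert c' B' := by
        obtain ⟨w, hw, rfl⟩ := Finset.mem_image.1 he
        rcases Sym2.mem_iff.1 hv with rfl | rfl
        · exact Finset.mem_insert_self _ _
        · exact Finset.mem_insert_of_mem hw
      have := Finset.disjoint_right.1 hdis hv'
      simpa using this
    have hb : B.card ≤ t := cφ ▸ Finset.card_le_card Finset.sdiff_subset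
    have hb' : B'.card ≤ t := cψ ▸ Finset.card_le_card Finset.sdiff_subset
    -- If no leaf had been dropped, the original stars would already be disjoint.
    have hbb : B.card + B'.card < 2 * t := by
      by_contra hcon
      have h3 : B = A := Finset.eq_of_subset_of_card_le Finset.sdiff_subset (by omega)
      have h4 : B' = A' := Finset.eq_of_subset_of_card_le Finset.sdiff_subset (by omega)
      rw [h3, h4] at hdis
      exact h hdis
    have hcard : (insert c A ∪ insert c' A').card = 2 + B.card + B'.card := by
      rw [hunion, Finset.card_union_of_disjoint hdis, Finset.card_insert_of_notMem hcB,
        Finset.card_insert_of_notMem hcB']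
      ring
    have hmom : ∀ a, 0 ≤ s ^ a * M.moment a := fun a =>
      mul_nonneg (pow_nonneg hs0 _) (moment_nonneg hQ a)
    rw [hcard, ← pow_mul]
    calc s ^ (2 * (2 + B.card + B'.card)) * M.coef (symmDiff (starEdges c A) (starEdges c' A'))
        ≤ s ^ (2 * (2 + B.card + B'.card)) * (M.moment B.card * M.moment B'.card) :=
          mul_le_mul_of_nonneg_left (hcoef ▸ coef_anti hQ hsub) (pow_nonneg hs0 _)
      _ = s ^ (4 + B.card + B'.card) *
          ((s ^ B.card * M.moment B.card) * (s ^ B'.card * M.moment B'.card)) := by ring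
      _ ≤ _ := pow_mul_mul_le hs hη hη1 (hmom t) (hmom _) (hmom _)
          (pow_mul_moment_le hQ hb hs0) (pow_mul_moment_le hQ hb' hs0)
          (fun h => by rw [h]) (fun h => by rw [h]) hb hb' hbb h1

lemma graphExp_starSum (M : SBM k) (n t : ℕ) :
    graphExp (M.law n) (starSum t) = n.descFactorial (t + 1) * M.moment t := by
  have h : graphExp (M.law n) (starSum t) =
    ∑ φ : Fin (t + 1) ↪ Fin n, graphExp (M.law n) (edgeChar (labelledStar φ)) := graphExp_sum _ _ _
  have h2 : ∀ φ : Fin (t + 1) ↪ Fin n,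
      graphExp (M.law n) (edgeChar (labelledStar φ)) = M.moment t := fun φ => by
    rw [M.graphExp_edgeChar (labelledStar_subset_pairs φ), labelledStar,
      M.coef_starEdges (centre_notMem_leaves φ), card_leaves]
  rw [h, Finset.sum_congr rfl fun φ _ => h2 φ, Finset.sum_const, Finset.card_univ,
    Fintype.card_embedding_eq, Fintype.card_fin, Fintype.card_fin, nsmul_eq_mul]

/-- Disjoint pairs cancel exactly; for the others the subtracted product of means is non-negative
and is dropped. -/
lemma graphVar_starSum_le_sum (hQ : ∀ i j, 0 ≤ M.Q i j) (n t : ℕ) :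
    graphVar (M.law n) (starSum t) ≤
      ∑ a : (Fin (t + 1) ↪ Fin n) × (Fin (t + 1) ↪ Fin n) with
        ¬ Disjoint (Finset.univ.image a.1) (Finset.univ.image a.2),
          M.coef (symmDiff (labelledStar a.1) (labelledStar a.2)) := by
  have h1 : graphExp (M.law n) (fun G => starSum t G ^ 2) =
      ∑ a : (Fin (t + 1) ↪ Fin n) × (Fin (t + 1) ↪ Fin n),
        M.coef (symmDiff (labelledStar a.1) (labelledStar a.2)) := by
    have h : ∀ G : SimpleGraph (Fin n), starSum t G ^ 2 =
        ∑ a : (Fin (t + 1) ↪ Fin n) × (Fin (t + 1) ↪ Fin n),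
          edgeChar (symmDiff (labelledStar a.1) (labelledStar a.2)) G := fun G => by
      simp only [sq, starSum, Finset.sum_mul_sum, edgeChar_mul, Fintype.sum_prod_type]
    rw [funext h, graphExp_sum]
    exact Finset.sum_congr rfl fun a _ => M.graphExp_edgeChar
      (symmDiff_subset_pairs (labelledStar_subset_pairs _) (labelledStar_subset_pairs _))
  have h2 : graphExp (M.law n) (starSum t) ^ 2 =
      ∑ a : (Fin (t + 1) ↪ Fin n) × (Fin (t + 1) ↪ Fin n),
        M.coef (labelledStar a.1) * M.coef (labelledStar a.2) := by
    have h : graphExp (M.law n) (starSum t) = ∑ φ : Fin (t + 1) ↪ Fin n,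
        M.coef (labelledStar φ) :=
      (graphExp_sum _ _ _).trans (Finset.sum_congr rfl fun φ _ =>
        M.graphExp_edgeChar (labelledStar_subset_pairs φ))
    rw [h, sq, Finset.sum_mul_sum, Fintype.sum_prod_type]
  rw [graphVar_eq (M.graphExp_one n), h1, h2, ← Finset.sum_sub_distrib, Finset.sum_filter]
  refine Finset.sum_le_sum fun a _ => ?_
  by_cases h : Disjoint (Finset.univ.image a.1) (Finset.univ.image a.2)
  · rw [if_neg (not_not.2 h), coef_symmDiff_of_disjoint M h, sub_self]
  · rw [if_pos h]
    exact sub_le_self _ (mul_nonneg (coef_nonneg hQ _) (coef_nonneg hQ _))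

lemma card_jointSupport_le (a : (Fin (t + 1) ↪ Fin n) × (Fin (t + 1) ↪ Fin n)) :
    (jointSupport a).card ≤ 2 * t + 2 := by
  have h : ∀ φ : Fin (t + 1) ↪ Fin n, (Finset.univ.image φ).card ≤ t + 1 := fun φ =>
    Finset.card_image_le.trans (by simp)
  have := Finset.card_union_le (Finset.univ.image a.1) (Finset.univ.image a.2)
  have := h a.1
  have := h a.2
  unfold jointSupport
  omega

lemma card_jointSupport_fibre_le
    (I : Finset ((Fin (t + 1) ↪ Fin n) × (Fin (t + 1) ↪ Fin n))) (V : Finset (Fin n)) :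
    (I.filter fun a => jointSupport a = V).card ≤ (V.card ^ (t + 1)) ^ 2 := by
  have h : (Fintype.piFinset (fun _ : Fin (t + 1) => V) ×ˢ
      Fintype.piFinset (fun _ : Fin (t + 1) => V)).card = (V.card ^ (t + 1)) ^ 2 := by
    rw [Finset.card_product, Fintype.card_piFinset_const, sq]
  rw [← h]
  refine Finset.card_le_card_of_injOn (fun a => (⇑a.1, ⇑a.2)) ?_ ?_
  · intro a ha
    obtain ⟨_, rfl⟩ := Finset.mem_filter.1 (Finset.mem_coe.1 ha)
    simp [jointSupport]
  · intro a _ b _ hab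
    obtain ⟨h1, h2⟩ := Prod.ext_iff.1 hab
    exact Prod.ext (DFunLike.coe_injective h1) (DFunLike.coe_injective h2)

/-- The variance of star counts in a model `N` whose coefficients are dominated by those of
`M`. -/
lemma graphVar_starSum_le {l : ℕ} {N : SBM l} (hN : ∀ i j, 0 ≤ N.Q i j)
    (hQ : ∀ i j, 0 ≤ M.Q i j)
    (hNM : ∀ S : Finset (Sym2 (Fin n)), N.coef S ≤ M.coef S) (hn : 0 < n) {η : ℝ}
    (hη : 0 ≤ η) (hη1 : η ≤ 1)
    (h1 : 1 + √n ^ t * M.moment t ≤ η * √n * (√n ^ t * M.moment t))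
    (h2 : 1 + √n ^ (2 * t) * M.moment (2 * t) ≤ η * √n ^ 2 * (√n ^ t * M.moment t) ^ 2) :
    graphVar (N.law n) (starSum t) ≤ ((2 * t + 2 : ℕ) + 1) * (((2 * t + 2) ^ (t + 1)) ^ 2 : ℕ) *
      (η * ((n : ℝ) ^ (t + 1) * M.moment t) ^ 2) := by
  have hs : 1 ≤ √(n : ℝ) := Real.one_le_sqrt.2 (Nat.one_le_cast.2 hn)
  have hb : η * ((n : ℝ) ^ (t + 1) * M.moment t) ^ 2 =
      η * √n ^ (2 * t + 4) * (√n ^ t * M.moment t) ^ 2 := by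
    rw [← Real.sq_sqrt (Nat.cast_nonneg n : (0 : ℝ) ≤ n),
      Real.sqrt_sq (Real.sqrt_nonneg _)]
    ring
  refine (graphVar_starSum_le_sum hN n t).trans ((Finset.sum_le_sum fun a _ => hNM _).trans ?_)
  refine sum_le_of_card_fibre_le hn _ jointSupport (fun a _ => card_jointSupport_le a) ?_
    (by positivity) ?_
  · intro V hV
    exact (card_jointSupport_fibre_le _ V).trans
      (Nat.pow_le_pow_left (Nat.pow_le_pow_left hV _) 2)
  · intro a ha
    have h := pow_mul_coef_symmDiff_le hQ hs hη hη1 h1 h2 (Finset.mem_filter.1 ha).2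
    rwa [Real.sq_sqrt (Nat.cast_nonneg n), ← hb] at h

end SBM

/-! ### From a successful test to a quantitative gap for star counts. -/

lemma graphVar_erdosRenyiHalf_nonneg {n : ℕ} (f : SimpleGraph (Fin n) → ℝ) :
    0 ≤ graphVar (erdosRenyiHalf n) f :=
  Finset.sum_nonneg fun G _ => mul_nonneg (by unfold erdosRenyiHalf; positivity) (sq_nonneg _)

/-- Rescaling a statistic does not affect how well it separates two laws. -/
lemma gap_of_gap_const_mul {n : ℕ} {w w' f : SimpleGraph (Fin n) → ℝ} {a C : ℝ} (ha : 0 < a)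
    (h : C * √(max (graphVar w fun G => a * f G) (graphVar w' fun G => a * f G)) <
      |graphExp w (fun G => a * f G) - graphExp w' (fun G => a * f G)|) :
    C * √(max (graphVar w f) (graphVar w' f)) < |graphExp w f - graphExp w' f| := by
  rw [graphVar_const_mul, graphVar_const_mul, graphExp_const_mul, graphExp_const_mul,
    ← mul_max_of_nonneg _ _ (sq_nonneg a), Real.sqrt_mul (sq_nonneg a), Real.sqrt_sq ha.le,
    ← mul_sub, abs_mul, abs_of_pos ha, mul_left_comm] at h
  exact lt_of_mul_lt_mul_left h ha.le

/-- The strict inequality rules out zero null variance, so the variance can be cancelled. -/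
lemma SBM.lt_sum_coef_sq {k : ℕ} (M : SBM k) {n D : ℕ} {f : SimpleGraph (Fin n) → ℝ}
    (hf : IsDegreeLE D f) {C : ℝ} (hC : 0 ≤ C)
    (h : C * √(max (graphVar (erdosRenyiHalf n) f) (graphVar (M.law n) f)) <
      |graphExp (erdosRenyiHalf n) f - graphExp (M.law n) f|) :
    C ^ 2 < ∑ S ∈ lowDegree n D, M.coef S ^ 2 := by
  have hV := graphVar_erdosRenyiHalf_nonneg f
  have h1 : C * √(graphVar (erdosRenyiHalf n) f) <
      |graphExp (erdosRenyiHalf n) f - graphExp (M.law n) f| :=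
    (mul_le_mul_of_nonneg_left (Real.sqrt_le_sqrt (le_max_left _ _)) hC).trans_lt h
  have h2 := pow_lt_pow_left₀ h1 (by positivity) two_ne_zero
  rw [mul_pow, Real.sq_sqrt hV, sq_abs, sub_sq_comm] at h2
  have h3 := h2.trans_le (M.sq_graphExp_sub_le hf.mem_charSpan)
  rw [mul_comm] at h3
  exact lt_of_mul_lt_mul_left h3 hV

lemma pow_le_two_pow_mul_descFactorial {n t : ℕ} (h : 2 * t ≤ n) :
    (n : ℝ) ^ (t + 1) ≤ 2 ^ (t + 1) * n.descFactorial (t + 1) := by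
  have h1 := Nat.pow_sub_le_descFactorial n (t + 1)
  have h2 : n ≤ 2 * (n + 1 - (t + 1)) := by omega
  have h3 : n ^ (t + 1) ≤ 2 ^ (t + 1) * n.descFactorial (t + 1) :=
    (Nat.pow_le_pow_left h2 _).trans (by
      rw [mul_pow]
      exact Nat.mul_le_mul_left _ h1)
  exact_mod_cast h3

lemma SBM.moment_null {t : ℕ} (ht : t ≠ 0) : SBM.null.moment t = 0 := by
  simp [moment, rowMean, null, ht]

/-- The constant in the variance bound for stars with at most `D` edges. -/
def varConst (D : ℕ) : ℝ := ((2 * D + 2 : ℕ) + 1) * (((2 * D + 2) ^ (D + 1)) ^ 2 : ℕ)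

lemma varConst_pos (D : ℕ) : 0 < varConst D := by unfold varConst; positivity

lemma varConst_mono {t D : ℕ} (h : t ≤ D) : varConst t ≤ varConst D := by
  have h1 : ((2 * t + 2) ^ (t + 1)) ^ 2 ≤ ((2 * D + 2) ^ (D + 1)) ^ 2 :=
    Nat.pow_le_pow_left ((Nat.pow_le_pow_left (by omega) _).trans
      (Nat.pow_le_pow_right (by omega) (by omega))) 2
  have h2 : 2 * t + 2 ≤ 2 * D + 2 := by omega
  have h1' : ((((2 * t + 2) ^ (t + 1)) ^ 2 : ℕ) : ℝ) ≤ (((2 * D + 2) ^ (D + 1)) ^ 2 : ℕ) :=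
    Nat.cast_le.2 h1
  have h2' : ((2 * t + 2 : ℕ) : ℝ) ≤ (2 * D + 2 : ℕ) := Nat.cast_le.2 h2
  unfold varConst
  gcongr

/-- If the normalized star coefficient is large and no label is rare, then star counts
separate the two laws. -/
lemma SBM.starSum_gap {k : ℕ} {M : SBM k} (hQ : ∀ i j, 0 ≤ M.Q i j) {n t D : ℕ} (ht : 1 ≤ t)
    (htD : t ≤ D) (hn : 0 < n) (hnt : 2 * D ≤ n) {C η : ℝ} (hη : 0 < η) (hη1 : η ≤ 1)
    (hCη : C ^ 2 * (varConst D * η) * (2 ^ (D + 1)) ^ 2 < 1)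
    (hs : 2 / η ≤ √n) (hm : 2 / η ≤ √n ^ (t + 1) * M.moment t)
    (hp : ∀ i, 0 < M.p i → 2 / η ≤ n * M.p i) :
    C * √(max (graphVar (erdosRenyiHalf n) (starSum t)) (graphVar (M.law n) (starSum t))) <
      |graphExp (erdosRenyiHalf n) (starSum t) - graphExp (M.law n) (starSum t)| := by
  have hn' : (0 : ℝ) < n := Nat.cast_pos.2 hn
  have hsn : √(n : ℝ) ^ 2 = n := Real.sq_sqrt hn'.le
  have hs0 : 0 < √(n : ℝ) := Real.sqrt_pos.2 hn'
  set m := √(n : ℝ) ^ t * M.moment t with hm_def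
  have hsm : √(n : ℝ) ^ (t + 1) * M.moment t = √n * m := by rw [hm_def]; ring
  rw [hsm] at hm
  have hη2 : 1 ≤ 2 / η := by rw [le_div_iff₀ hη]; linarith
  have hm1 : 2 ≤ η * (√n * m) := by rwa [div_le_iff₀' hη] at hm
  have hs1 : 2 ≤ η * √n := by rwa [div_le_iff₀' hη] at hs
  have hm0 : 0 < m := by
    have : 0 < √n * m := (by positivity : 0 < 2 / η).trans_le hm
    exact pos_of_mul_pos_right this hs0.le
  have h1 : 1 + m ≤ η * √n * m := by
    have := mul_le_mul_of_nonneg_right hs1 hm0.le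
    linarith
  -- Each summand on the left takes half of the right side, hence the thresholds $2/\eta$: the
  -- moment by the bound on label probabilities, the 1 because $\sqrt n\,m\ge 2/\eta\ge 1$.
  have h2 : 1 + √n ^ (2 * t) * M.moment (2 * t) ≤ η * √n ^ 2 * m ^ 2 := by
    have h3 : 2 / η * (√n ^ (2 * t) * M.moment (2 * t)) ≤ √n ^ 2 * m ^ 2 := by
      have hq : ∀ i, 0 < M.p i → 2 / η / n ≤ M.p i := fun i hi => by
        rw [div_le_iff₀' hn']
        exact hp i hi
      have := mul_le_mul_of_nonneg_left (moment_two_mul_le hQ hq t)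
        (by positivity : 0 ≤ √(n : ℝ) ^ (2 * t) * n)
      have e : √(n : ℝ) ^ (2 * t) * n * (2 / η / n * M.moment (2 * t)) =
          2 / η * (√n ^ (2 * t) * M.moment (2 * t)) := by
        field_simp
      rw [e] at this
      refine this.trans_eq ?_
      rw [hm_def, hsn]
      ring
    have h4 : 2 / η ≤ √n ^ 2 * m ^ 2 := by
      rw [← mul_pow]
      exact hm.trans (le_self_pow₀ (hη2.trans hm) two_ne_zero)
    rw [div_mul_eq_mul_div, div_le_iff₀ hη] at h3
    rw [div_le_iff₀ hη] at h4
    linarith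
  have hnull : ∀ S : Finset (Sym2 (Fin n)), SBM.null.coef S ≤ M.coef S := fun S => by
    rw [coef_null]
    split_ifs with h
    · rw [h, coef_empty]
    · exact coef_nonneg hQ S
  have v1 := graphVar_starSum_le hQ hQ (fun _ => le_rfl) hn hη.le hη1 h1 h2
  have v0 := graphVar_starSum_le (N := SBM.null) (fun _ _ => le_rfl) hQ hnull hn hη.le hη1 h1 h2
  rw [law_null] at v0
  have e0 := SBM.null.graphExp_starSum n t
  rw [law_null, moment_null (by omega), mul_zero] at e0
  have hμ : 0 < M.moment t := pos_of_mul_pos_right hm0 (by positivity)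
  set X := (n : ℝ) ^ (t + 1) * M.moment t with hX
  have hX0 : 0 < X := by positivity
  have hmax := max_le v0 v1
  have hvar : max (graphVar (erdosRenyiHalf n) (starSum t)) (graphVar (M.law n) (starSum t)) ≤
      varConst D * η * X ^ 2 := by
    refine hmax.trans ?_
    rw [mul_assoc (varConst D)]
    exact mul_le_mul_of_nonneg_right (varConst_mono htD) (by positivity)
  rw [e0, zero_sub, abs_neg, M.graphExp_starSum n t,
    abs_of_nonneg (mul_nonneg (Nat.cast_nonneg _) hμ.le)]
  have hmean : X ≤ 2 ^ (D + 1) * (n.descFactorial (t + 1) * M.moment t) := by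
    rw [hX, ← mul_assoc]
    refine mul_le_mul_of_nonneg_right ?_ hμ.le
    refine (pow_le_two_pow_mul_descFactorial (by omega)).trans ?_
    exact mul_le_mul_of_nonneg_right (pow_le_pow_right₀ one_le_two (by omega))
      (Nat.cast_nonneg _)
  set Y := (n.descFactorial (t + 1) : ℝ) * M.moment t
  have hY0 : 0 ≤ Y := mul_nonneg (Nat.cast_nonneg _) hμ.le
  refine lt_of_pow_lt_pow_left₀ 2 hY0 ?_
  have hsq : √(max (graphVar (erdosRenyiHalf n) (starSum t))
      (graphVar (M.law n) (starSum t))) ^ 2 ≤ varConst D * η * X ^ 2 := by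
    rw [Real.sq_sqrt ((graphVar_erdosRenyiHalf_nonneg _).trans (le_max_left _ _))]
    exact hvar
  have hYX : X ^ 2 ≤ (2 ^ (D + 1)) ^ 2 * Y ^ 2 := by
    rw [← mul_pow]
    exact pow_le_pow_left₀ hX0.le hmean 2
  have hYpos : 0 < Y ^ 2 := by
    by_contra hcon
    have : Y ^ 2 = 0 := le_antisymm (not_lt.1 hcon) (sq_nonneg _)
    rw [this, mul_zero] at hYX
    exact absurd hYX (not_le.2 (by positivity))
  have hK := varConst_pos D
  rw [mul_pow]
  calc _ ≤ C ^ 2 * (varConst D * η * X ^ 2) := mul_le_mul_of_nonneg_left hsq (sq_nonneg _)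
    _ ≤ C ^ 2 * (varConst D * η * ((2 ^ (D + 1)) ^ 2 * Y ^ 2)) := by gcongr
    _ = (C ^ 2 * (varConst D * η) * (2 ^ (D + 1)) ^ 2) * Y ^ 2 := by ring
    _ < 1 * Y ^ 2 := mul_lt_mul_of_pos_right hCη hYpos
    _ = Y ^ 2 := one_mul _

end

theorem mainTheorem8 (D : ℕ) (k : ℕ → ℕ) (M : ∀ n, SBM (k n))
    (hQ : ∀ n i j, 0 ≤ (M n).Q i j)
    (hp : ∀ C : ℝ, ∀ᶠ n : ℕ in atTop, ∀ i, 0 < (M n).p i → C ≤ n * (M n).p i)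
    (hD : ∃ f : ∀ n : ℕ, SimpleGraph (Fin n) → ℝ,
      (∀ n, IsDegreeLE D (f n)) ∧
        DistinguishesWHP erdosRenyiHalf (fun n => (M n).law n) f) :
    ∃ t : ℕ → ℕ, (∀ n, 1 ≤ t n ∧ t n ≤ D) ∧
      DistinguishesWHP erdosRenyiHalf (fun n => (M n).law n)
        (fun n G => signedCount (starWithEdges (t n)) G) := by
  obtain ⟨f, hf, hdist⟩ := hD
  have key : ∀ B : ℝ, ∀ᶠ n : ℕ in atTop, ∃ t, 1 ≤ t ∧ t ≤ D ∧
      B < √n ^ (t + 1) * (M n).moment t := by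
    intro B
    set B' := max B 1 with hB'
    -- $C^2$ is the second-moment bound available if all normalized moments were at most `B'`;
    -- beating it gives a contradiction.
    set C : ℝ := √(((2 * D : ℕ) + 1) * (2 ^ ((2 * D) ^ 2) : ℕ) * (B' ^ (2 * D)) ^ 2) with hC
    filter_upwards [hdist C, eventually_gt_atTop 0] with n hn hn0
    have h := (M n).lt_sum_coef_sq (hf n) (Real.sqrt_nonneg _) hn
    rw [Real.sq_sqrt (by positivity)] at h
    by_contra! hcon
    exact absurd (SBM.sum_coef_sq_le (hQ n) hn0 (le_max_right B 1)
      fun t h1 h2 => (hcon t h1 h2).trans (le_max_left B 1)) (not_le.2 h)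
  have hD1 : 1 ≤ D := by
    obtain ⟨n, t, h1, h2, _⟩ := (key 0).exists
    omega
  -- The index in `key` may vary with `B`; the maximiser depends on `n` alone and works for all
  -- thresholds.
  have hmax : ∀ n : ℕ, ∃ t ∈ Finset.Icc 1 D, ∀ t' ∈ Finset.Icc 1 D,
      √n ^ (t' + 1) * (M n).moment t' ≤ √n ^ (t + 1) * (M n).moment t := fun n =>
    Finset.exists_max_image _ _ ⟨1, by simpa using hD1⟩
  choose t ht htmax using hmax
  have ht' : ∀ n, 1 ≤ t n ∧ t n ≤ D := fun n => Finset.mem_Icc.1 (ht n)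
  refine ⟨t, ht', fun C => ?_⟩
  -- `C` may be negative, hence the truncation; $\eta=1/(K+1)$ ensures $K\eta<1$.
  set K := max C 0 ^ 2 * varConst D * (2 ^ (D + 1)) ^ 2 with hK
  have hK0 : 0 ≤ K := by
    have := (varConst_pos D).le
    positivity
  set η : ℝ := 1 / (K + 1) with hη
  have hη0 : 0 < η := by positivity
  have hη1 : η ≤ 1 := by
    rw [hη, div_le_one (by positivity)]
    linarith
  have hCη : max C 0 ^ 2 * (varConst D * η) * (2 ^ (D + 1)) ^ 2 < 1 := by
    have e : max C 0 ^ 2 * (varConst D * η) * (2 ^ (D + 1)) ^ 2 = K / (K + 1) := by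
      rw [hη, hK]; ring
    rw [e, div_lt_one (by positivity)]
    linarith
  have hsqrt : ∀ᶠ n : ℕ in atTop, 2 / η ≤ √n :=
    (Real.tendsto_sqrt_atTop.comp tendsto_natCast_atTop_atTop).eventually_ge_atTop _
  filter_upwards [hp (2 / η), key (2 / η), hsqrt, eventually_gt_atTop 0,
    eventually_ge_atTop (2 * D)] with n hpn hkey hs hn0 hn2
  obtain ⟨t', h1, h2, h3⟩ := hkey
  have hm := h3.le.trans (htmax n t' (Finset.mem_Icc.2 ⟨h1, h2⟩))
  have hgap := SBM.starSum_gap (hQ n) (ht' n).1 (ht' n).2 hn0 hn2 hη0 hη1 hCη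
    hs hm hpn
  have hfin : Finite (starWithEdges (t n) ≃g starWithEdges (t n)) :=
    Finite.of_injective (fun α => (α : Fin (t n + 1) → Fin (t n + 1))) DFunLike.coe_injective
  have ha : (0 : ℝ) < Nat.card (starWithEdges (t n) ≃g starWithEdges (t n)) :=
    Nat.cast_pos.2 (Nat.card_pos_iff.2 ⟨⟨SimpleGraph.Iso.refl⟩, hfin⟩)
  rw [show starSum (n := n) (t n) = fun G => Nat.card (starWithEdges (t n) ≃g starWithEdges (t n)) *
    signedCount (starWithEdges (t n)) G from funext starSum_eq] at hgap
  refine lt_of_le_of_lt ?_ (gap_of_gap_const_mul ha hgap)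
  exact mul_le_mul_of_nonneg_right (le_max_left C 0) (Real.sqrt_nonneg _)
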